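/- Consider the plant $x_{s+1}=Ax_s+Bu_s+w_s$ with $x_0=0$, where $A\in\mathbb R^{n\times n}$, $B\in\mathbb R^{n\times m}$, and $w_s\sim N(0,W)$ are i.i.d. with $W\succ0$. Let $Q\succ0$, $R\succ0$. The cost of a controller is $$J=\limsup_{T\to\infty}\frac1T\,\mathbb E\Big[\sum_{s=0}^{T-1}x_s^TQx_s+u_s^TRu_s\Big]\in[0,\infty].$$ Let $P^*\succ0$ satisfy $P^*=Q+A^TP^*A-A^TP^*B(R+B^TP^*B)^{-1}B^TP^*A$, and let $K^*=-(R+B^TP^*B)^{-1}B^TP^*A$ be the optimal LQR gain. Let $K_0$ be a fallback gain with spectral radius $\rho(A+BK_0)<1$. For a gain $K_1$, a threshold $M\ge0$ and a dwell time $t\in\mathbb N$, the switched strategy keeps a counter $\xi\in\mathbb N$, initially $0$. At each step with state $x$: if $\xi>0$, it applies $u=K_0x$; if $\xi=0$ and $\|x\|\ge M$, it sets $\xi\leftarrow t$ and applies $u=K_0x$; otherwise it applies $u=K_1x$. Then $\xi\leftarrow\max\{\xi-1,0\}$. Denote its cost by $J^{K_1,M,t}$, and the cost of the linear controller $u=K_1x$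 by $J^{K_1}$. Let $K_{1,k}$ $(k\in\mathbb N)$ be (deterministic) gains with $\lim_{k\to\infty}K_{1,k}=K^*$, and let $M_k\ge0$ and $t_k\in\mathbb N$ satisfy $M_k=\Theta(\log k)$ and $t_k=\Theta(\log k)$ as $k\to\infty$. Then: 1. There exist $P\succ0$, $0<\rho<1$ and $t_0\in\mathbb N$ such that for all sufficiently large $k$ and all integers $s\ge t_0$, $$(A+BK_{1,k})^TP(A+BK_{1,k})\prec\rho P,\qquad \big((A+BK_0)^{s}\big)^TP(A+BK_0)^{s}\prec\rho P,$$ and such that for all sufficiently large $k$ one has $t_k\ge t_0$ and $M_k\ge\sqrt{3\|\tilde W\|\|P\|\|P^{-1}\|}/(1-\rho^{1/4})$, where $\tilde W=\sum_{\tau\ge0}(A+BK_0)^\tau W((A+BK_0)^\tau)^T$ and $\|\cdot\|$ is the spectral norm. In particular the two Lyapunov inequalities hold with $s=t_k$ for all sufficiently large $k$. 2. For all sufficiently large $k$ the costs $J^{K_{1,k},M_k,t_k}$ and $J^{K_{1,k}}$ are finite, and for every $\alpha>0$, $$J^{K_{1,k},M_k,t_k}-J^{K_{1,k}}=O(k^{-\alpha})\qquad(k\to\infty).$$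 -/

import Mathlib

open Filter Asymptotics MeasureTheory ProbabilityTheory
open scoped Topology ENNReal Matrix

namespace SwitchedLQR

/-- The matrix-vector product on Euclidean spaces. -/
noncomputable def act {p q : ℕ} (F : Matrix (Fin p) (Fin q) ℝ)
    (x : EuclideanSpace ℝ (Fin q)) : EuclideanSpace ℝ (Fin p) :=
  WithLp.toLp 2 (F *ᵥ x.ofLp)

/-- The quadratic form `xᵀ F x`. -/
noncomputable def quad {p : ℕ} (F : Matrix (Fin p) (Fin p) ℝ)
    (x : EuclideanSpace ℝ (Fin p)) : ℝ :=
  x.ofLp ⬝ᵥ (F *ᵥ x.ofLp)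

/-- The induced 2-norm of a square matrix. -/
noncomputable def specNorm {p : ℕ} (F : Matrix (Fin p) (Fin p) ℝ) : ℝ :=
  ‖Matrix.toEuclideanCLM (n := Fin p) (𝕜 := ℝ) F‖

/-- A square real matrix is Schur stable if its spectral radius (over the complex numbers) is
less than one. -/
def IsSchurStable {p : ℕ} (F : Matrix (Fin p) (Fin p) ℝ) : Prop :=
  spectralRadius ℂ (F.map (fun r : ℝ => (r : ℂ))) < 1

/-- `P` is the positive definite solution of the discrete-time algebraic Riccati equation. -/
def IsRiccatiSolution {n m : ℕ} (A : Matrix (Fin n) (Fin n) ℝ) (B : Matrix (Fin n) (Fin m) ℝ)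
    (Q : Matrix (Fin n) (Fin n) ℝ) (R : Matrix (Fin m) (Fin m) ℝ)
    (P : Matrix (Fin n) (Fin n) ℝ) : Prop :=
  P.PosDef ∧ P = Q + Aᵀ * P * A - Aᵀ * P * B * (R + Bᵀ * P * B)⁻¹ * Bᵀ * P * A

/-- The linear-quadratic feedback gain `-(R + Bᵀ P B)⁻¹ Bᵀ P A` (for the input `u = K x`). -/
noncomputable def lqrGain {n m : ℕ} (A : Matrix (Fin n) (Fin n) ℝ) (B : Matrix (Fin n) (Fin m) ℝ)
    (R : Matrix (Fin m) (Fin m) ℝ) (P : Matrix (Fin n) (Fin n) ℝ) : Matrix (Fin m) (Fin n) ℝ :=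
  -((R + Bᵀ * P * B)⁻¹ * Bᵀ * P * A)

/-- A controller with an internal counter: it maps the current state `x` and the current counter
value `ξ` to the input `u` and the next counter value `ξ'`. -/
abbrev Controller (n m : ℕ) : Type :=
  EuclideanSpace ℝ (Fin n) → ℕ → EuclideanSpace ℝ (Fin m) × ℕ

/-- The linear feedback `u = K x` (the counter is not used). -/
noncomputable def linearController {n m : ℕ} (K : Matrix (Fin m) (Fin n) ℝ) : Controller n m :=
  fun x _ => (act K x, 0)

/-- The switched control strategy with primary gain `K₁`, fallback gain `K₀`, switching threshold
`M` and dwell time `t`. (Subtraction on `ℕ` is truncated, so `ξ - 1` is `max {ξ - 1, 0}`.) -/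
noncomputable def switchedController {n m : ℕ} (K₁ K₀ : Matrix (Fin m) (Fin n) ℝ) (M : ℝ) (t : ℕ) :
    Controller n m :=
  fun x ξ =>
    if 0 < ξ then (act K₀ x, ξ - 1)
    else if M ≤ ‖x‖ then (act K₀ x, t - 1)
    else (act K₁ x, 0)

/-- State and counter of the closed loop `x (k+1) = A x k + B u k + w k`, from `x 0 = 0` and
counter value `0`, along one realization `w` of the process noise. -/
noncomputable def closedLoop {n m : ℕ} (A : Matrix (Fin n) (Fin n) ℝ) (B : Matrix (Fin n) (Fin m) ℝ)
    (c : Controller n m) (w : ℕ → EuclideanSpace ℝ (Fin n)) : ℕ → EuclideanSpace ℝ (Fin n) × ℕ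
  | 0 => (0, 0)
  | k + 1 =>
    let x := (closedLoop A B c w k).1
    let ξ := (closedLoop A B c w k).2
    (act A x + act B (c x ξ).1 + w k, (c x ξ).2)

/-- The stage cost `x_kᵀ Q x_k + u_kᵀ R u_k` along one realization of the noise. -/
noncomputable def stageCost {n m : ℕ} (A : Matrix (Fin n) (Fin n) ℝ) (B : Matrix (Fin n) (Fin m) ℝ)
    (Q : Matrix (Fin n) (Fin n) ℝ) (R : Matrix (Fin m) (Fin m) ℝ)
    (c : Controller n m) (w : ℕ → EuclideanSpace ℝ (Fin n)) (k : ℕ) : ℝ :=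
  let x := (closedLoop A B c w k).1
  let u := (c x (closedLoop A B c w k).2).1
  quad Q x + quad R u

/-- The infinite-horizon cost `limsup_T (1/T) E ∑_{k<T} (x_kᵀ Q x_k + u_kᵀ R u_k)`, as an extended
nonnegative real; it is meant for positive semidefinite `Q` and `R`. -/
noncomputable def lqCost {n m : ℕ} (A : Matrix (Fin n) (Fin n) ℝ) (B : Matrix (Fin n) (Fin m) ℝ)
    (Q : Matrix (Fin n) (Fin n) ℝ) (R : Matrix (Fin m) (Fin m) ℝ)
    {Ω : Type*} [MeasurableSpace Ω] (μ : Measure Ω) (w : ℕ → Ω → EuclideanSpace ℝ (Fin n))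
    (c : Controller n m) : ℝ≥0∞ :=
  limsup (fun T : ℕ =>
    (∫⁻ ω, ENNReal.ofReal
      (∑ k ∈ Finset.range T, stageCost A B Q R c (fun j => w j ω) k) ∂μ) / (T : ℝ≥0∞)) atTop

/-- The common Lyapunov condition
`(A + B K₁)ᵀ P (A + B K₁) < ρ P` and `((A + B K₀)^t)ᵀ P (A + B K₀)^t < ρ P`,
where `X < Y` means that `Y - X` is positive definite. -/
def CommonLyapunov {n m : ℕ} (A : Matrix (Fin n) (Fin n) ℝ) (B : Matrix (Fin n) (Fin m) ℝ)
    (K₁ K₀ : Matrix (Fin m) (Fin n) ℝ) (ρ : ℝ) (P : Matrix (Fin n) (Fin n) ℝ) (t : ℕ) : Prop :=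
  (ρ • P - (A + B * K₁)ᵀ * P * (A + B * K₁)).PosDef ∧
  (ρ • P - ((A + B * K₀) ^ t)ᵀ * P * (A + B * K₀) ^ t).PosDef

/-- `W̃ = ∑_τ (A + B K₀)^τ W ((A + B K₀)^τ)ᵀ`, the stationary covariance under the fallback. -/
noncomputable def fallbackCov {n m : ℕ} (A : Matrix (Fin n) (Fin n) ℝ)
    (B : Matrix (Fin n) (Fin m) ℝ) (K₀ : Matrix (Fin m) (Fin n) ℝ)
    (W : Matrix (Fin n) (Fin n) ℝ) : Matrix (Fin n) (Fin n) ℝ :=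
  ∑' τ : ℕ, (A + B * K₀) ^ τ * W * ((A + B * K₀) ^ τ)ᵀ

/-- The threshold level `M₀ = √(3 ‖W̃‖ ‖P‖ ‖P⁻¹‖) / (1 - ρ^{1/4})`. -/
noncomputable def thresholdLevel {n m : ℕ} (A : Matrix (Fin n) (Fin n) ℝ)
    (B : Matrix (Fin n) (Fin m) ℝ) (K₀ : Matrix (Fin m) (Fin n) ℝ)
    (W : Matrix (Fin n) (Fin n) ℝ) (ρ : ℝ) (P : Matrix (Fin n) (Fin n) ℝ) : ℝ :=
  Real.sqrt (3 * specNorm (fallbackCov A B K₀ W) * specNorm P * specNorm P⁻¹) /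
    (1 - ρ ^ (1 / 4 : ℝ))

end SwitchedLQR

/-!
The switched and the linear closed loop are compared along one noise realization, and expectations
are taken only of explicit functions of the norms of the noise.

*Lyapunov inequalities.* The Riccati equation gives `P - Fᵀ P F = Q + Kᵀ R K` for the optimal closed
loop `F = A + B K`, so `ρ P - Fᵀ P F` is positive definite for some `ρ < 1`. Positive definiteness
is an open condition (`eventually_posDef`), hence the inequality persists for nearby gains, and it
holds for high powers of the fallback closed loop because these tend to zero
(`exists_eventually_commonLyapunov`).

*Uniform pathwise stability.* The primary closed loop contracts the norm of `P`, the fallback closed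
loop contracts another norm (`exists_contracting_seminorm`). For dwell times above a constant,
a Lyapunov function weighted by the counter contracts in every step, at a rate that depends neither
on the dwell time nor on the threshold (`IsSwitchedPath.norm_le`). Thus `‖z k‖ ≤ a * S k`, where `S`
is a geometrically discounted sum of the norms of the noise. By convexity of `exp` and Fernique's
theorem, each exponential moment of `S k` is bounded uniformly in `k`
(`exists_integralLE_exp_discountedSum`).

*The gap.* The difference `d` of the two trajectories satisfies
`d (k+1) = (A + B K₁) d k + B (K₀ - K₁) z k` when the fallback is active at time `k`, and the same
recursion without the last term otherwise. The fallback is active only if the state exceeded `M` at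
one of the last `t` times, and the indicator of this is at most
`∑ l < t, exp (lam * (a * S (k - l) - M))`. Hence the expected stage costs differ by at most
`C * (t + 1) * exp (-(lam * M / 2))`, where the rate `lam` is arbitrary and `C` does not depend on
the primary gain, on `M` or on `t` (`exists_lqCost_gap`). For `M` and `t` of order
`log k` this is smaller than any power of `k` (`exists_rate`).
-/

namespace SwitchedLQR

/-! ### Discounted sums -/

/-- The solution of the scalar recursion `S (k+1) = r * S k + b * v k` with `S 0 = 0`. -/
noncomputable def discountedSum (r b : ℝ) (v : ℕ → ℝ) : ℕ → ℝ
  | 0 => 0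
  | k + 1 => r * discountedSum r b v k + b * v k

theorem discountedSum_nonneg {r b : ℝ} {v : ℕ → ℝ} (hr : 0 ≤ r) (hb : 0 ≤ b) (hv : ∀ k, 0 ≤ v k)
    (k : ℕ) : 0 ≤ discountedSum r b v k := by
  induction k with
  | zero => simp [discountedSum]
  | succ k ih => have := hv k; simp only [discountedSum]; positivity

theorem le_discountedSum {r b : ℝ} {v x : ℕ → ℝ} (hr : 0 ≤ r) (h0 : x 0 ≤ 0)
    (hx : ∀ k, x (k + 1) ≤ r * x k + b * v k) (k : ℕ) : x k ≤ discountedSum r b v k := by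
  induction k with
  | zero => simpa [discountedSum] using h0
  | succ k ih =>
    have := mul_le_mul_of_nonneg_left ih hr
    simp only [discountedSum]; linarith [hx k]

/-- Squares of a contracting recursion are again dominated by a discounted sum: the square is
convex, and `r * x + e` is the convex combination of `x` and `e / (1 - r)`. -/
theorem sq_le_discountedSum {r : ℝ} {e x v : ℕ → ℝ} (hr : 0 ≤ r) (hr1 : r < 1) (hx0 : ∀ k, 0 ≤ x k)
    (h0 : x 0 = 0) (hx : ∀ k, x (k + 1) ≤ r * x k + e k) (hev : ∀ k, e k ^ 2 ≤ v k) (k : ℕ) :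
    x k ^ 2 ≤ discountedSum r (1 - r)⁻¹ v k := by
  refine le_discountedSum (x := fun k => x k ^ 2) hr (by simp [h0]) (fun k => ?_) k
  have h1 : 0 < 1 - r := by linarith
  have h2 : x (k + 1) ^ 2 ≤ (r * x k + e k) ^ 2 := pow_le_pow_left₀ (hx0 _) (hx k) 2
  have h3 : (r * x k + e k) ^ 2 ≤ r * x k ^ 2 + (1 - r)⁻¹ * e k ^ 2 := by
    have : r * x k ^ 2 + (1 - r)⁻¹ * e k ^ 2 - (r * x k + e k) ^ 2
        = r * (1 - r)⁻¹ * ((1 - r) * x k - e k) ^ 2 := by field_simp; ring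
    have h4 : 0 ≤ r * (1 - r)⁻¹ * ((1 - r) * x k - e k) ^ 2 := by positivity
    linarith
  have h5 := mul_le_mul_of_nonneg_left (hev k) (inv_nonneg.2 h1.le)
  linarith

/-! ### Pathwise stability of the switched recursion -/

/-- `z` and `ξ` are a trajectory and its counter for the switched recursion with fallback dynamics
`f₀`, primary dynamics `f₁`, threshold `M`, dwell time `t` and noise realization `w`. -/
structure IsSwitchedPath {E : Type*} [NormedAddCommGroup E] (f₀ f₁ : E → E) (M : ℝ) (t : ℕ)
    (w z : ℕ → E) (ξ : ℕ → ℕ) : Prop where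
  zero : z 0 = 0
  counter_zero : ξ 0 = 0
  step : ∀ k, (0 < ξ k ∧ z (k + 1) = f₀ (z k) + w k ∧ ξ (k + 1) = ξ k - 1) ∨
    (ξ k = 0 ∧ M ≤ ‖z k‖ ∧ z (k + 1) = f₀ (z k) + w k ∧ ξ (k + 1) = t - 1) ∨
    (ξ k = 0 ∧ ‖z k‖ < M ∧ z (k + 1) = f₁ (z k) + w k ∧ ξ (k + 1) = 0)

/-- A bound for `S k ^ 2` on the event that the fallback is active at time `k`, when `a * S`
dominates the state (see `IsSwitchedPath.sq_le_excursion`). Each term comes from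
`1 ≤ exp (lam * (a * S (k - l) - M))`, valid when the state at time `k - l` exceeds `M`. -/
noncomputable def excursion (lam a M : ℝ) (t : ℕ) (S : ℕ → ℝ) (k : ℕ) : ℝ :=
  Real.exp (-(lam * M)) *
    ∑ l ∈ Finset.range t, (Real.exp (2 * lam * a * S (k - l)) + Real.exp (2 * S k))

theorem excursion_nonneg (lam a M : ℝ) (t : ℕ) (S : ℕ → ℝ) (k : ℕ) :
    0 ≤ excursion lam a M t S k := by unfold excursion; positivity

namespace IsSwitchedPath

variable {E : Type*} [NormedAddCommGroup E] {f₀ f₁ : E → E} {M : ℝ} {t : ℕ} {w z : ℕ → E}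
  {ξ : ℕ → ℕ}

/-- The fallback is active only within a window of length `t` after a large state. (For `k < l` the
truncated subtraction `k - l` is `0`.) -/
theorem exists_large_of_fallback (h : IsSwitchedPath f₀ f₁ M t w z ξ) (ht : 1 ≤ t) (k : ℕ)
    (hk : 0 < ξ k ∨ M ≤ ‖z k‖) : ∃ l < t, M ≤ ‖z (k - l)‖ := by
  have key : ∀ k, 0 < ξ k → ∃ l, l + ξ k ≤ t ∧ M ≤ ‖z (k - l)‖ := by
    intro k
    induction k with
    | zero => intro h0; rw [h.counter_zero] at h0; exact absurd h0 (lt_irrefl _)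
    | succ k ih =>
      intro hpos
      rcases h.step k with ⟨h1, -, h3⟩ | ⟨-, h2, -, h4⟩ | ⟨-, -, -, h4⟩
      · obtain ⟨l, hl, hM⟩ := ih h1
        exact ⟨l + 1, by omega, by rwa [Nat.add_sub_add_right]⟩
      · exact ⟨1, by omega, by simpa using h2⟩
      · omega
  rcases hk with hk | hk
  · obtain ⟨l, hl, hM⟩ := key k hk
    exact ⟨l, by omega, hM⟩
  · exact ⟨0, by omega, by simpa using hk⟩

/-- Uniform exponential stability of the switched recursion. The norms `N₀` and `N₁` contract under
the fallback and under the primary dynamics. The Lyapunov function is `N₁ z` when the counter is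
zero and `β ξ * N₀ z` when it is positive, where `β j = max κ⁻¹ (κ * q ^ j)`: the weight grows as
the fallback phase runs out, slowly enough for the contraction of `N₀` to absorb the growth, and
a dwell time with `κ² q ^ t ≤ 1` pays for exchanging the norms. -/
theorem norm_le [NormedSpace ℝ E] (h : IsSwitchedPath f₀ f₁ M t w z ξ) (ht : 1 ≤ t)
    {N₀ N₁ : Seminorm ℝ E} {c r q s : ℝ} (hc : 1 ≤ c) (hq0 : 0 ≤ q) (hq1 : q ≤ 1)
    (hs : 0 < s) (hqs : q * s = r) (hrs : r ≤ s)
    (hN₀ : ∀ x, N₀ x ≤ c * ‖x‖) (hN₀' : ∀ x, ‖x‖ ≤ c * N₀ x)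
    (hN₁ : ∀ x, N₁ x ≤ c * ‖x‖) (hN₁' : ∀ x, ‖x‖ ≤ c * N₁ x)
    (hf₀ : ∀ x, N₀ (f₀ x) ≤ r * N₀ x) (hf₁ : ∀ x, N₁ (f₁ x) ≤ r * N₁ x)
    (hqt : (c ^ 2) ^ 2 * q ^ t ≤ 1) (k : ℕ) :
    ‖z k‖ ≤ c ^ 3 * discountedSum s (c ^ 3) (fun j => ‖w j‖) k := by
  have hc0 : 0 < c := by linarith
  obtain ⟨κ, hκ⟩ : ∃ κ, κ = c ^ 2 := ⟨_, rfl⟩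
  have hκ1 : 1 ≤ κ := by rw [hκ]; nlinarith
  have hκ0 : 0 < κ := by linarith
  have hcκ : c ^ 3 = c * κ := by rw [hκ]; ring
  have hr : 0 ≤ r := by rw [← hqs]; positivity
  obtain ⟨β, hβ⟩ : ∃ β : ℕ → ℝ, β = fun j => max κ⁻¹ (κ * q ^ j) := ⟨_, rfl⟩
  have hβ_ge : ∀ j, κ⁻¹ ≤ β j := fun j => by rw [hβ]; exact le_max_left _ _
  have hβ_pos : ∀ j, 0 < β j := fun j => (inv_pos.2 hκ0).trans_le (hβ_ge j)
  have hβ_le : ∀ j, β j ≤ κ := fun j => by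
    rw [hβ]
    exact max_le ((inv_le_one_of_one_le₀ hκ1).trans hκ1)
      (mul_le_of_le_one_right hκ0.le (pow_le_one₀ hq0 hq1))
  have hβ_zero : κ ≤ β 0 := by rw [hβ]; simp
  have hβ_step : ∀ j, β j * r ≤ s * β (j + 1) := fun j => by
    rw [hβ]
    simp only
    rw [max_mul_of_nonneg _ _ hr, mul_max_of_nonneg _ _ hs.le]
    refine max_le_max ?_ (le_of_eq ?_)
    · rw [mul_comm]; exact mul_le_mul_of_nonneg_right hrs (inv_pos.2 hκ0).le
    · rw [← hqs]; ring
  have hβ_t : β t * κ ≤ 1 := by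
    rw [hβ]
    simp only
    rw [max_mul_of_nonneg _ _ hκ0.le, inv_mul_cancel₀ hκ0.ne']
    refine max_le le_rfl ?_
    rw [hκ]
    nlinarith
  have h01 : ∀ x, N₀ x ≤ κ * N₁ x := fun x => by
    rw [hκ]; nlinarith [hN₀ x, mul_le_mul_of_nonneg_left (hN₁' x) hc0.le]
  have h10 : ∀ x, N₁ x ≤ κ * N₀ x := fun x => by
    rw [hκ]; nlinarith [hN₁ x, mul_le_mul_of_nonneg_left (hN₀' x) hc0.le]
  obtain ⟨H, hH⟩ : ∃ H : E → ℕ → ℝ, H = fun x j => if j = 0 then N₁ x else β j * N₀ x := ⟨_, rfl⟩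
  have hH_le : ∀ x j, H x j ≤ β j * N₀ x := fun x j => by
    rw [hH]
    by_cases hj : j = 0
    · simp only [hj, if_true]
      exact (h10 x).trans (mul_le_mul_of_nonneg_right hβ_zero (apply_nonneg _ _))
    · simp [hj]
  have hnorm_le : ∀ x j, ‖x‖ ≤ c * κ * H x j := fun x j => by
    rw [hH]
    by_cases hj : j = 0
    · simp only [hj, if_true]
      have h1 : 0 ≤ N₁ x := apply_nonneg _ _
      nlinarith [hN₁' x, mul_le_mul_of_nonneg_left hκ1 (mul_nonneg hc0.le h1)]
    · simp only [hj, if_false]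
      have h1 : 0 ≤ N₀ x := apply_nonneg _ _
      have h2 : 1 ≤ κ * β j := by
        have := mul_le_mul_of_nonneg_left (hβ_ge j) hκ0.le
        rwa [mul_inv_cancel₀ hκ0.ne'] at this
      have h3 := mul_le_mul_of_nonneg_right h2 (mul_nonneg hc0.le h1)
      nlinarith [hN₀' x]
  have hnoise : ∀ j x, β j * N₀ x ≤ c ^ 3 * ‖x‖ := fun j x => by
    rw [hcκ]
    calc β j * N₀ x ≤ κ * (c * ‖x‖) :=
          mul_le_mul (hβ_le j) (hN₀ x) (apply_nonneg _ _) hκ0.le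
      _ = _ := by ring
  have hstep : ∀ k, H (z (k + 1)) (ξ (k + 1)) ≤ s * H (z k) (ξ k) + c ^ 3 * ‖w k‖ := by
    intro k
    rcases h.step k with ⟨h1, h2, h3⟩ | ⟨h1, -, h2, h3⟩ | ⟨h1, -, h2, h3⟩
    · obtain ⟨j, hj⟩ : ∃ j, ξ k = j + 1 := ⟨ξ k - 1, by omega⟩
      rw [h3, hj, Nat.add_sub_cancel, h2]
      have e1 : H (z k) (j + 1) = β (j + 1) * N₀ (z k) := by rw [hH]; simp
      rw [e1]
      calc H (f₀ (z k) + w k) j ≤ β j * N₀ (f₀ (z k) + w k) := hH_le _ _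
        _ ≤ β j * (r * N₀ (z k) + N₀ (w k)) :=
            mul_le_mul_of_nonneg_left ((map_add_le_add _ _ _).trans
              (add_le_add (hf₀ _) le_rfl)) (hβ_pos j).le
        _ = (β j * r) * N₀ (z k) + β j * N₀ (w k) := by ring
        _ ≤ (s * β (j + 1)) * N₀ (z k) + c ^ 3 * ‖w k‖ :=
            add_le_add (mul_le_mul_of_nonneg_right (hβ_step j) (apply_nonneg _ _)) (hnoise _ _)
        _ = _ := by ring
    · obtain ⟨j, rfl⟩ : ∃ j, t = j + 1 := ⟨t - 1, by omega⟩
      rw [h3, h1, Nat.add_sub_cancel, h2]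
      have e1 : H (z k) 0 = N₁ (z k) := by rw [hH]; simp
      rw [e1]
      calc H (f₀ (z k) + w k) j ≤ β j * N₀ (f₀ (z k) + w k) := hH_le _ _
        _ ≤ β j * (r * N₀ (z k) + N₀ (w k)) :=
            mul_le_mul_of_nonneg_left ((map_add_le_add _ _ _).trans
              (add_le_add (hf₀ _) le_rfl)) (hβ_pos j).le
        _ = (β j * r) * N₀ (z k) + β j * N₀ (w k) := by ring
        _ ≤ (s * β (j + 1)) * (κ * N₁ (z k)) + c ^ 3 * ‖w k‖ :=
            add_le_add (mul_le_mul (hβ_step j) (h01 _) (apply_nonneg _ _)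
              (mul_nonneg hs.le (hβ_pos _).le)) (hnoise _ _)
        _ = s * (β (j + 1) * κ) * N₁ (z k) + c ^ 3 * ‖w k‖ := by ring
        _ ≤ s * 1 * N₁ (z k) + c ^ 3 * ‖w k‖ := by
            gcongr
        _ = _ := by ring
    · rw [h3, h1, h2, hH]
      simp only [if_true]
      calc N₁ (f₁ (z k) + w k) ≤ r * N₁ (z k) + c * ‖w k‖ :=
            (map_add_le_add _ _ _).trans (add_le_add (hf₁ _) (hN₁ _))
        _ ≤ s * N₁ (z k) + c ^ 3 * ‖w k‖ := by
            gcongr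
            exact le_self_pow₀ hc (by norm_num)
  have h0 : H (z 0) (ξ 0) ≤ 0 := by rw [h.zero, h.counter_zero, hH]; simp
  rw [hcκ]
  refine (hnorm_le _ (ξ k)).trans (mul_le_mul_of_nonneg_left ?_ (by positivity))
  rw [← hcκ]
  exact le_discountedSum (x := fun k => H (z k) (ξ k)) hs.le h0 hstep k

theorem sq_le_excursion (h : IsSwitchedPath f₀ f₁ M t w z ξ) (ht : 1 ≤ t) {lam a : ℝ}
    (hlam : 0 ≤ lam) {S : ℕ → ℝ} (hS : ∀ k, 0 ≤ S k) (hz : ∀ k, ‖z k‖ ≤ a * S k) (k : ℕ)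
    (hk : 0 < ξ k ∨ M ≤ ‖z k‖) : S k ^ 2 ≤ excursion lam a M t S k := by
  obtain ⟨l, hl, hM⟩ := h.exists_large_of_fallback ht k hk
  have h1 : lam * M ≤ lam * (a * S (k - l)) := mul_le_mul_of_nonneg_left (hM.trans (hz _)) hlam
  have h2 : S k ^ 2 ≤ 2 * Real.exp (S k) := by
    linarith [Real.quadratic_le_exp_of_nonneg (hS k), hS k]
  have h3 : 1 ≤ Real.exp (-(lam * M)) * Real.exp (lam * a * S (k - l)) := by
    rw [← Real.exp_add]; exact Real.one_le_exp (by linarith)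
  have h4 : 2 * Real.exp (lam * a * S (k - l)) * Real.exp (S k) ≤
      Real.exp (2 * lam * a * S (k - l)) + Real.exp (2 * S k) := by
    have e1 : Real.exp (2 * lam * a * S (k - l)) = Real.exp (lam * a * S (k - l)) ^ 2 := by
      rw [← Real.exp_nat_mul]; congr 1; push_cast; ring
    have e2 : Real.exp (2 * S k) = Real.exp (S k) ^ 2 := by
      rw [← Real.exp_nat_mul]; congr 1
    rw [e1, e2]
    exact two_mul_le_add_sq _ _
  calc S k ^ 2 ≤ 1 * (2 * Real.exp (S k)) := by linarith
    _ ≤ (Real.exp (-(lam * M)) * Real.exp (lam * a * S (k - l))) * (2 * Real.exp (S k)) := by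
        gcongr
    _ = Real.exp (-(lam * M)) * (2 * Real.exp (lam * a * S (k - l)) * Real.exp (S k)) := by ring
    _ ≤ Real.exp (-(lam * M)) * (Real.exp (2 * lam * a * S (k - l)) + Real.exp (2 * S k)) := by
        gcongr
    _ ≤ excursion lam a M t S k := by
        unfold excursion
        gcongr
        exact Finset.single_le_sum
          (f := fun l => Real.exp (2 * lam * a * S (k - l)) + Real.exp (2 * S k))
          (fun i _ => by positivity) (Finset.mem_range.2 hl)

end IsSwitchedPath

/-! ### Moments -/

/-- Every exponential moment of the norm of a Gaussian vector is finite (by Fernique's theorem). -/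
theorem integrable_exp_mul_norm_of_isGaussian {E : Type*} [NormedAddCommGroup E] [NormedSpace ℝ E]
    [CompleteSpace E] [SecondCountableTopology E] [MeasurableSpace E] [BorelSpace E]
    (ν : Measure E) [IsGaussian ν] (lam : ℝ) : Integrable (fun x => Real.exp (lam * ‖x‖)) ν := by
  obtain ⟨C, hC, hint⟩ := IsGaussian.exists_integrable_exp_sq ν
  refine (hint.const_mul (Real.exp (lam ^ 2 / (4 * C)))).mono'
    (by fun_prop) (Eventually.of_forall fun x => ?_)
  rw [Real.norm_eq_abs, Real.abs_exp, ← Real.exp_add]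
  refine Real.exp_le_exp.2 ?_
  have h : lam ^ 2 / (4 * C) + C * ‖x‖ ^ 2 - lam * ‖x‖ = (lam - 2 * C * ‖x‖) ^ 2 / (4 * C) := by
    field_simp; ring
  have h' : 0 ≤ (lam - 2 * C * ‖x‖) ^ 2 / (4 * C) := by positivity
  linarith

variable {Ω : Type*} [MeasurableSpace Ω] {μ : Measure Ω}

/-- The function `f` is integrable and its integral is at most `K`. Integrability is included
because the Bochner integral of a non-integrable function is `0`. -/
def IntegralLE (μ : Measure Ω) (f : Ω → ℝ) (K : ℝ) : Prop :=
  Integrable f μ ∧ ∫ ω, f ω ∂μ ≤ K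

namespace IntegralLE

theorem add {f g : Ω → ℝ} {K L : ℝ} (hf : IntegralLE μ f K) (hg : IntegralLE μ g L) :
    IntegralLE μ (fun ω => f ω + g ω) (K + L) :=
  ⟨hf.1.add hg.1, by rw [integral_add hf.1 hg.1]; exact add_le_add hf.2 hg.2⟩

theorem const_mul {f : Ω → ℝ} {K : ℝ} (hf : IntegralLE μ f K) {a : ℝ} (ha : 0 ≤ a) :
    IntegralLE μ (fun ω => a * f ω) (a * K) :=
  ⟨hf.1.const_mul a, by rw [integral_const_mul]; exact mul_le_mul_of_nonneg_left hf.2 ha⟩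

theorem sum {ι : Type*} {f : ι → Ω → ℝ} {K : ℝ} (s : Finset ι) (hf : ∀ i, IntegralLE μ (f i) K) :
    IntegralLE μ (fun ω => ∑ i ∈ s, f i ω) (s.card * K) := by
  refine ⟨integrable_finsetSum _ fun i _ => (hf i).1, ?_⟩
  rw [integral_finsetSum _ fun i _ => (hf i).1, ← nsmul_eq_mul]
  exact Finset.sum_le_card_nsmul _ _ _ fun i _ => (hf i).2

theorem mono {f : Ω → ℝ} {K L : ℝ} (hf : IntegralLE μ f K) (h : K ≤ L) : IntegralLE μ f L :=
  ⟨hf.1, hf.2.trans h⟩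

theorem discountedSum {r b K : ℝ} {v : ℕ → Ω → ℝ} (hr : 0 ≤ r) (hr1 : r < 1) (hb : 0 ≤ b)
    (hK : 0 ≤ K) (hv : ∀ k, IntegralLE μ (v k) K) (k : ℕ) :
    IntegralLE μ (fun ω => SwitchedLQR.discountedSum r b (fun j => v j ω) k) (b * K / (1 - r)) := by
  have h1 : 0 < 1 - r := by linarith
  induction k with
  | zero => exact ⟨by simp [SwitchedLQR.discountedSum], by
      simp only [SwitchedLQR.discountedSum, integral_zero]; positivity⟩
  | succ k ih =>
    refine ((ih.const_mul hr).add ((hv k).const_mul hb)).mono (le_of_eq ?_)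
    field_simp; ring

end IntegralLE

/-- Exponential moments of a discounted sum are bounded uniformly in time, by convexity of the
exponential function. -/
theorem integralLE_exp_discountedSum [IsProbabilityMeasure μ] {r b lam K : ℝ} {v : ℕ → Ω → ℝ}
    (hr : 0 ≤ r) (hr1 : r < 1) (hK : 1 ≤ K) (hvm : ∀ k, AEMeasurable (v k) μ)
    (hv : ∀ k, IntegralLE μ (fun ω => Real.exp (lam * b / (1 - r) * v k ω)) K) (k : ℕ) :
    IntegralLE μ (fun ω => Real.exp (lam * discountedSum r b (fun j => v j ω) k)) K := by
  have h1 : 0 < 1 - r := by linarith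
  have hm : ∀ k, AEMeasurable (fun ω => discountedSum r b (fun j => v j ω) k) μ := by
    intro k
    induction k with
    | zero => simp only [discountedSum]; fun_prop
    | succ k ih => have := hvm k; simp only [discountedSum]; fun_prop
  induction k with
  | zero => exact ⟨by simp [discountedSum], by simpa [discountedSum] using hK⟩
  | succ k ih =>
    have hsum := (ih.const_mul hr).add ((hv k).const_mul h1.le)
    have hle : ∀ ω, Real.exp (lam * discountedSum r b (fun j => v j ω) (k + 1)) ≤
        r * Real.exp (lam * discountedSum r b (fun j => v j ω) k) +
          (1 - r) * Real.exp (lam * b / (1 - r) * v k ω) := by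
      intro ω
      have := convexOn_exp.2 (Set.mem_univ (lam * discountedSum r b (fun j => v j ω) k))
        (Set.mem_univ (lam * b / (1 - r) * v k ω)) hr h1.le (by ring)
      simp only [smul_eq_mul] at this
      refine le_trans (le_of_eq ?_) this
      simp only [discountedSum]
      congr 1
      field_simp
    have hint : Integrable
        (fun ω => Real.exp (lam * discountedSum r b (fun j => v j ω) (k + 1))) μ := by
      refine hsum.1.mono' ?_ (Eventually.of_forall fun ω => ?_)
      · have := hm (k + 1)
        exact (Real.measurable_exp.comp_aemeasurable (this.const_mul lam)).aestronglyMeasurable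
      · rw [Real.norm_eq_abs, Real.abs_exp]; exact hle ω
    refine ⟨hint, (integral_mono hint hsum.1 hle).trans (hsum.2.trans (le_of_eq (by ring)))⟩

theorem integralLE_excursion {lam a M K : ℝ} {t : ℕ} {S : Ω → ℕ → ℝ}
    (h1 : ∀ k, IntegralLE μ (fun ω => Real.exp (2 * lam * a * S ω k)) K)
    (h2 : ∀ k, IntegralLE μ (fun ω => Real.exp (2 * S ω k)) K) (k : ℕ) :
    IntegralLE μ (fun ω => excursion lam a M t (S ω) k)
      (Real.exp (-(lam * M)) * (t * (K + K))) := by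
  have := (IntegralLE.sum (Finset.range t) fun l => (h1 (k - l)).add (h2 k)).const_mul
    (Real.exp_pos (-(lam * M))).le
  rwa [Finset.card_range] at this

section Matrices

open scoped Matrix.Norms.L2Operator MatrixOrder

/-! ### Matrices acting on Euclidean space -/

variable {p q l : ℕ}

theorem act_mul (F : Matrix (Fin p) (Fin q) ℝ) (G : Matrix (Fin q) (Fin l) ℝ)
    (x : EuclideanSpace ℝ (Fin l)) : act (F * G) x = act F (act G x) := by
  simp [act, Matrix.mulVec_mulVec]

theorem act_add_left (F G : Matrix (Fin p) (Fin q) ℝ) (x : EuclideanSpace ℝ (Fin q)) :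
    act (F + G) x = act F x + act G x := by
  ext i; simp [act, Matrix.add_mulVec]

theorem act_sub_left (F G : Matrix (Fin p) (Fin q) ℝ) (x : EuclideanSpace ℝ (Fin q)) :
    act (F - G) x = act F x - act G x := by
  ext i; simp [act, Matrix.sub_mulVec]

theorem act_add (F : Matrix (Fin p) (Fin q) ℝ) (x y : EuclideanSpace ℝ (Fin q)) :
    act F (x + y) = act F x + act F y := by
  ext i; simp [act, Matrix.mulVec_add]

theorem act_sub (F : Matrix (Fin p) (Fin q) ℝ) (x y : EuclideanSpace ℝ (Fin q)) :
    act F (x - y) = act F x - act F y := by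
  ext i; simp [act, Matrix.mulVec_sub]

theorem act_smul (F : Matrix (Fin p) (Fin q) ℝ) (a : ℝ) (x : EuclideanSpace ℝ (Fin q)) :
    act F (a • x) = a • act F x := by
  ext i; simp [act, Matrix.mulVec_smul]

theorem norm_act_le (F : Matrix (Fin p) (Fin q) ℝ) (x : EuclideanSpace ℝ (Fin q)) :
    ‖act F x‖ ≤ ‖F‖ * ‖x‖ :=
  Matrix.l2_opNorm_mulVec F x

theorem quad_eq_inner (F : Matrix (Fin p) (Fin p) ℝ) (x : EuclideanSpace ℝ (Fin p)) :
    quad F x = inner ℝ x (act F x) := by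
  simp [quad, act, EuclideanSpace.inner_eq_star_dotProduct, dotProduct_comm]

theorem abs_quad_le (F : Matrix (Fin p) (Fin p) ℝ) (x : EuclideanSpace ℝ (Fin p)) :
    |quad F x| ≤ ‖F‖ * ‖x‖ ^ 2 := by
  rw [quad_eq_inner]
  calc _ ≤ ‖x‖ * ‖act F x‖ := abs_real_inner_le_norm _ _
    _ ≤ ‖x‖ * (‖F‖ * ‖x‖) := by gcongr; exact norm_act_le F x
    _ = _ := by ring

theorem abs_quad_sub_quad_le (F : Matrix (Fin p) (Fin p) ℝ) (x y : EuclideanSpace ℝ (Fin p)) :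
    |quad F x - quad F y| ≤ ‖F‖ * (‖x‖ + ‖y‖) * ‖x - y‖ := by
  have h : quad F x - quad F y = inner ℝ x (act F (x - y)) + inner ℝ (x - y) (act F y) := by
    rw [quad_eq_inner, quad_eq_inner, act_sub, inner_sub_right, inner_sub_left]; ring
  rw [h]
  calc _ ≤ |inner ℝ x (act F (x - y))| + |inner ℝ (x - y) (act F y)| := abs_add_le _ _
    _ ≤ ‖x‖ * (‖F‖ * ‖x - y‖) + ‖x - y‖ * (‖F‖ * ‖y‖) := by
        gcongr
        · exact (abs_real_inner_le_norm _ _).trans (by gcongr; exact norm_act_le F _)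
        · exact (abs_real_inner_le_norm _ _).trans (by gcongr; exact norm_act_le F _)
    _ = _ := by ring

theorem quad_sub (F G : Matrix (Fin p) (Fin p) ℝ) (x : EuclideanSpace ℝ (Fin p)) :
    quad (F - G) x = quad F x - quad G x := by
  simp [quad, Matrix.sub_mulVec]

theorem quad_smul (a : ℝ) (F : Matrix (Fin p) (Fin p) ℝ) (x : EuclideanSpace ℝ (Fin p)) :
    quad (a • F) x = a * quad F x := by
  simp [quad, Matrix.smul_mulVec]

theorem quad_transpose_mul_mul (F : Matrix (Fin q) (Fin q) ℝ) (G : Matrix (Fin q) (Fin p) ℝ)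
    (x : EuclideanSpace ℝ (Fin p)) : quad (Gᵀ * F * G) x = quad F (act G x) := by
  simp only [quad, act, ← Matrix.mulVec_mulVec]
  rw [Matrix.dotProduct_mulVec, Matrix.vecMul_transpose]

/-! ### Positive definite matrices -/

/-- A positive definite quadratic form is the square of a norm `x ↦ ‖C x‖` with `C` invertible. -/
theorem exists_quad_eq_norm_sq {P : Matrix (Fin p) (Fin p) ℝ} (hP : P.PosDef) :
    ∃ C : Matrix (Fin p) (Fin p) ℝ, IsUnit C ∧ ∀ x, quad P x = ‖act C x‖ ^ 2 := by
  obtain ⟨C, hC⟩ := CStarAlgebra.nonneg_iff_eq_star_mul_self.1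
    (Matrix.nonneg_iff_posSemidef.2 hP.posSemidef)
  rw [Matrix.star_eq_conjTranspose, Matrix.conjTranspose_eq_transpose_of_trivial] at hC
  refine ⟨C, ?_, fun x => ?_⟩
  · have := (Matrix.isUnit_iff_isUnit_det _).1 hP.isUnit
    rw [hC, Matrix.det_mul] at this
    exact (Matrix.isUnit_iff_isUnit_det _).2 (isUnit_of_mul_isUnit_right this)
  · have h : P = Cᵀ * 1 * C := by rw [hC, Matrix.mul_one]
    rw [h, quad_transpose_mul_mul, quad_eq_inner]
    have : ∀ y : EuclideanSpace ℝ (Fin p), act 1 y = y := fun y => by simp [act]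
    rw [this, real_inner_self_eq_norm_sq]

theorem norm_le_of_isUnit {C : Matrix (Fin p) (Fin p) ℝ} (hC : IsUnit C)
    (x : EuclideanSpace ℝ (Fin p)) : ‖x‖ ≤ ‖C⁻¹‖ * ‖act C x‖ := by
  have h : act C⁻¹ (act C x) = x := by
    rw [← act_mul, Matrix.nonsing_inv_mul _ ((Matrix.isUnit_iff_isUnit_det _).1 hC)]
    simp [act]
  calc ‖x‖ = ‖act C⁻¹ (act C x)‖ := by rw [h]
    _ ≤ _ := norm_act_le _ _

theorem exists_le_quad {P : Matrix (Fin p) (Fin p) ℝ} (hP : P.PosDef) :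
    ∃ a > 0, ∀ x, a * ‖x‖ ^ 2 ≤ quad P x := by
  obtain ⟨C, hC, hq⟩ := exists_quad_eq_norm_sq hP
  refine ⟨((‖C⁻¹‖ + 1) ^ 2)⁻¹, by positivity, fun x => ?_⟩
  rw [hq, inv_mul_le_iff₀ (by positivity), ← mul_pow]
  refine pow_le_pow_left₀ (norm_nonneg _) ((norm_le_of_isUnit hC x).trans ?_) 2
  gcongr; linarith

theorem posDef_of_quad_pos {P : Matrix (Fin p) (Fin p) ℝ} (h : P.IsHermitian)
    (hq : ∀ x : EuclideanSpace ℝ (Fin p), x ≠ 0 → 0 < quad P x) : P.PosDef := by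
  refine Matrix.PosDef.of_dotProduct_mulVec_pos h fun x hx => ?_
  have := hq (WithLp.toLp 2 x) (by simpa using hx)
  simpa [quad] using this

theorem quad_pos {P : Matrix (Fin p) (Fin p) ℝ} (hP : P.PosDef) {x : EuclideanSpace ℝ (Fin p)}
    (hx : x ≠ 0) : 0 < quad P x := by
  have := hP.dotProduct_mulVec_pos (x := x.ofLp) (by simpa using hx)
  simpa [quad] using this

/-- Positive definiteness is an open condition on symmetric matrices. -/
theorem eventually_posDef {ι : Type*} {f : Filter ι} {H : ι → Matrix (Fin p) (Fin p) ℝ}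
    {G : Matrix (Fin p) (Fin p) ℝ} (hG : G.PosDef) (hH : Tendsto H f (𝓝 G))
    (hs : ∀ i, (H i).IsHermitian) : ∀ᶠ i in f, (H i).PosDef := by
  obtain ⟨a, ha, hq⟩ := exists_le_quad hG
  filter_upwards [hH (Metric.ball_mem_nhds G ha)] with i hi
  refine posDef_of_quad_pos (hs i) fun x hx => ?_
  have hi' : ‖H i - G‖ < a := by simpa [dist_eq_norm] using hi
  have h1 := (abs_le.1 (abs_quad_le (H i - G) x)).1
  rw [quad_sub] at h1
  have h2 : 0 < ‖x‖ ^ 2 := by positivity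
  nlinarith [hq x]

/-! ### Lyapunov inequalities -/

/-- The value function of the regulator decreases along the optimal closed loop by the stage
cost. -/
theorem IsRiccatiSolution.sub_closedLoop {n m : ℕ} {A : Matrix (Fin n) (Fin n) ℝ}
    {B : Matrix (Fin n) (Fin m) ℝ} {Q : Matrix (Fin n) (Fin n) ℝ} {R : Matrix (Fin m) (Fin m) ℝ}
    {P : Matrix (Fin n) (Fin n) ℝ} (hR : R.PosDef) (hP : IsRiccatiSolution A B Q R P) :
    P - (A + B * lqrGain A B R P)ᵀ * P * (A + B * lqrGain A B R P) =
      Q + (lqrGain A B R P)ᵀ * R * lqrGain A B R P := by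
  obtain ⟨hPpos, hric⟩ := hP
  have hPt : Pᵀ = P := by simpa using hPpos.isHermitian.eq
  have hRt : Rᵀ = R := by simpa using hR.isHermitian.eq
  obtain ⟨S, hS⟩ : ∃ S, S = R + Bᵀ * P * B := ⟨_, rfl⟩
  have hSpos : S.PosDef := by
    rw [hS]
    refine hR.add_posSemidef ?_
    simpa using hPpos.posSemidef.conjTranspose_mul_mul_same B
  have hSdet : IsUnit S.det := (Matrix.isUnit_iff_isUnit_det _).1 hSpos.isUnit
  obtain ⟨K, hK⟩ : ∃ K, K = lqrGain A B R P := ⟨_, rfl⟩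
  have hSK : S * K = -(Bᵀ * P * A) := by
    rw [hK, lqrGain, ← hS, Matrix.mul_neg, Matrix.mul_assoc, Matrix.mul_assoc,
      Matrix.mul_nonsing_inv_cancel_left _ _ hSdet, Matrix.mul_assoc]
  have hKS : Kᵀ * S = -(Aᵀ * P * B) := by
    have := congrArg Matrix.transpose hSK
    have hSt : Sᵀ = S := by simpa using hSpos.isHermitian.eq
    simpa [Matrix.transpose_mul, hPt, hSt, Matrix.mul_assoc] using this
  have hlast : Aᵀ * P * B * (R + Bᵀ * P * B)⁻¹ * Bᵀ * P * A = -(Aᵀ * P * B * K) := by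
    rw [hK, lqrGain]; simp only [Matrix.mul_neg, neg_neg, Matrix.mul_assoc]
  have hRS : R = S - Bᵀ * P * B := by rw [hS]; abel
  rw [← hK]
  have e1 : Kᵀ * R * K = -(Aᵀ * P * B) * K - Kᵀ * (Bᵀ * P * B) * K := by
    rw [hRS, Matrix.mul_sub, Matrix.sub_mul, hKS]
  have e2 : Kᵀ * Bᵀ * P * A = Aᵀ * P * B * K := by
    have : Kᵀ * (S * K) = Kᵀ * S * K := by rw [Matrix.mul_assoc]
    rw [hSK, hKS] at this
    simpa [Matrix.mul_assoc] using this
  have e3 : P = Q + Aᵀ * P * A + Aᵀ * P * B * K := by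
    conv_lhs => rw [hric, hlast]
    abel
  rw [e1, Matrix.transpose_add, Matrix.transpose_mul]
  simp only [Matrix.add_mul, Matrix.mul_add, Matrix.mul_assoc, Matrix.neg_mul] at e2 e3 ⊢
  rw [e2]
  refine sub_eq_zero.1 (Eq.trans ?_ (sub_eq_zero.2 e3))
  abel

theorem tendsto_pow_of_isSchurStable {F : Matrix (Fin p) (Fin p) ℝ} (hF : IsSchurStable F) :
    Tendsto (fun k : ℕ => F ^ k) atTop (𝓝 0) := by
  obtain ⟨G, hG⟩ : ∃ G : Matrix (Fin p) (Fin p) ℂ, G = F.map (fun r : ℝ => (r : ℂ)) := ⟨_, rfl⟩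
  rw [IsSchurStable, ← hG] at hF
  obtain ⟨r, hr, hr1⟩ := ENNReal.lt_iff_exists_nnreal_btwn.1 hF
  have hr1' : r < 1 := by exact_mod_cast hr1
  have hev : ∀ᶠ k : ℕ in atTop, ‖G ^ k‖₊ ≤ r ^ k := by
    filter_upwards [(spectrum.pow_nnnorm_pow_one_div_tendsto_nhds_spectralRadius G).eventually
      (gt_mem_nhds hr), eventually_gt_atTop 0] with k hk hk0
    have hk0' : (0 : ℝ) < k := by exact_mod_cast hk0
    have h := ENNReal.rpow_le_rpow hk.le hk0'.le
    rw [← ENNReal.rpow_mul, one_div, inv_mul_cancel₀ hk0'.ne', ENNReal.rpow_one,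
      ENNReal.rpow_natCast] at h
    exact_mod_cast h
  have hlim : Tendsto (fun k : ℕ => G ^ k) atTop (𝓝 0) := by
    rw [tendsto_zero_iff_norm_tendsto_zero]
    refine squeeze_zero' (Eventually.of_forall fun _ => norm_nonneg _)
      (hev.mono fun k hk => ?_) (tendsto_pow_atTop_nhds_zero_of_lt_one r.2 hr1')
    exact_mod_cast hk
  have hmap : ∀ k : ℕ, (F ^ k) = (G ^ k).map Complex.re := by
    intro k
    have : G ^ k = (F ^ k).map (fun r : ℝ => (r : ℂ)) := by
      rw [hG]; exact (map_pow (Complex.ofRealHom.mapMatrix (m := Fin p)) F k).symm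
    rw [this]; ext i j; simp
  have hre : Continuous (fun H : Matrix (Fin p) (Fin p) ℂ => H.map Complex.re) :=
    continuous_id.matrix_map Complex.continuous_re
  have := (hre.tendsto 0).comp hlim
  have h0 : (0 : Matrix (Fin p) (Fin p) ℂ).map Complex.re = 0 := by ext; simp
  rw [h0] at this
  exact this.congr fun k => (hmap k).symm

/-- A matrix with powers tending to zero is a strict contraction for an equivalent norm, namely
`∑ j < L, r ^ (-j) * ‖F ^ j x‖` where `‖F ^ L‖ ≤ 1 / 2 ≤ r ^ L`. -/
theorem exists_contracting_seminorm {F : Matrix (Fin p) (Fin p) ℝ}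
    (hF : Tendsto (fun k : ℕ => F ^ k) atTop (𝓝 0)) :
    ∃ (N : Seminorm ℝ (EuclideanSpace ℝ (Fin p))) (c r : ℝ), 1 ≤ c ∧ 0 < r ∧ r < 1 ∧
      (∀ x, ‖x‖ ≤ c * N x) ∧ (∀ x, N x ≤ c * ‖x‖) ∧ (∀ x, N (act F x) ≤ r * N x) := by
  obtain ⟨L, hL1, hL⟩ : ∃ L : ℕ, 1 ≤ L ∧ ‖F ^ L‖ ≤ 1 / 2 := by
    have h := (tendsto_zero_iff_norm_tendsto_zero.1 hF).eventually (ge_mem_nhds one_half_pos)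
    exact ((eventually_ge_atTop 1).and h).exists
  have hL0 : (1 : ℝ) ≤ L := by exact_mod_cast hL1
  obtain ⟨r, hr⟩ : ∃ r : ℝ, r = 1 - 1 / (2 * L) := ⟨_, rfl⟩
  have hu : 1 / (2 * (L : ℝ)) ≤ 1 / 2 := by gcongr; linarith
  have hu0 : 0 < 1 / (2 * (L : ℝ)) := by positivity
  have hr0 : 0 < r := by rw [hr]; linarith
  have hr1 : r < 1 := by rw [hr]; linarith
  have hrL : 1 / 2 ≤ r ^ L := by
    have h := one_add_mul_le_pow (a := -(1 / (2 * (L : ℝ)))) (by linarith) L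
    have e : 1 + (L : ℝ) * -(1 / (2 * (L : ℝ))) = 1 / 2 := by field_simp; ring
    rwa [e, ← sub_eq_add_neg, ← hr] at h
  obtain ⟨N, hN⟩ : ∃ N : Seminorm ℝ (EuclideanSpace ℝ (Fin p)),
      ∀ x, N x = ∑ j ∈ Finset.range L, r⁻¹ ^ j * ‖act (F ^ j) x‖ := by
    refine ⟨Seminorm.of (fun x => ∑ j ∈ Finset.range L, r⁻¹ ^ j * ‖act (F ^ j) x‖)
      (fun x y => ?_) (fun a x => ?_), fun x => rfl⟩
    · rw [← Finset.sum_add_distrib]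
      refine Finset.sum_le_sum fun j _ => ?_
      rw [← mul_add, act_add]
      gcongr
      exact norm_add_le _ _
    · rw [Finset.mul_sum]
      refine Finset.sum_congr rfl fun j _ => ?_
      rw [act_smul, norm_smul]; ring
  have hterm : ∀ x, ‖x‖ ≤ N x := fun x => by
    rw [hN]
    have := Finset.single_le_sum (f := fun j => r⁻¹ ^ j * ‖act (F ^ j) x‖)
      (fun j _ => by positivity) (Finset.mem_range.2 hL1)
    simpa [act] using this
  refine ⟨N, 1 + ∑ j ∈ Finset.range L, r⁻¹ ^ j * ‖F ^ j‖, r, ?_, hr0, hr1, fun x => ?_,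
    fun x => ?_, fun x => ?_⟩
  · have : 0 ≤ ∑ j ∈ Finset.range L, r⁻¹ ^ j * ‖F ^ j‖ := by positivity
    linarith
  · have h1 : 0 ≤ ∑ j ∈ Finset.range L, r⁻¹ ^ j * ‖F ^ j‖ := by positivity
    have h2 : 0 ≤ N x := apply_nonneg _ _
    nlinarith [hterm x]
  · rw [hN, add_mul, Finset.sum_mul]
    have : ∑ j ∈ Finset.range L, r⁻¹ ^ j * ‖act (F ^ j) x‖ ≤
        ∑ j ∈ Finset.range L, r⁻¹ ^ j * ‖F ^ j‖ * ‖x‖ := by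
      refine Finset.sum_le_sum fun j _ => ?_
      rw [mul_assoc]
      gcongr
      exact norm_act_le _ _
    linarith [norm_nonneg x]
  · have e1 : N (act F x) = r * ∑ j ∈ Finset.range L, r⁻¹ ^ (j + 1) * ‖act (F ^ (j + 1)) x‖ := by
      rw [hN, Finset.mul_sum]
      refine Finset.sum_congr rfl fun j _ => ?_
      rw [pow_succ F, act_mul, pow_succ]
      field_simp
    have e2 : ∑ j ∈ Finset.range L, r⁻¹ ^ (j + 1) * ‖act (F ^ (j + 1)) x‖ + ‖x‖ =
        N x + r⁻¹ ^ L * ‖act (F ^ L) x‖ := by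
      rw [hN, ← Finset.sum_range_succ (fun j => r⁻¹ ^ j * ‖act (F ^ j) x‖),
        Finset.sum_range_succ' (fun j => r⁻¹ ^ j * ‖act (F ^ j) x‖)]
      simp [act]
    have e3 : r⁻¹ ^ L * ‖act (F ^ L) x‖ ≤ ‖x‖ := by
      rw [inv_pow, inv_mul_le_iff₀ (by positivity)]
      refine (norm_act_le _ _).trans ?_
      exact mul_le_mul_of_nonneg_right (hL.trans hrL) (norm_nonneg _)
    rw [e1]
    exact mul_le_mul_of_nonneg_left (by linarith) hr0.le

/-- The norm `x ↦ √(xᵀ P x)`, with its equivalence to the Euclidean norm. -/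
theorem exists_seminorm_sq_eq_quad {P : Matrix (Fin p) (Fin p) ℝ} (hP : P.PosDef) :
    ∃ (N : Seminorm ℝ (EuclideanSpace ℝ (Fin p))) (c : ℝ), 1 ≤ c ∧ (∀ x, ‖x‖ ≤ c * N x) ∧
      (∀ x, N x ≤ c * ‖x‖) ∧ (∀ x, N x ^ 2 = quad P x) := by
  obtain ⟨C, hC, hq⟩ := exists_quad_eq_norm_sq hP
  refine ⟨Seminorm.of (fun x => ‖act C x‖) (fun x y => ?_) (fun a x => ?_),
    1 + ‖C‖ + ‖C⁻¹‖, ?_, fun x => ?_, fun x => ?_, fun x => (hq x).symm⟩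
  · rw [act_add]; exact norm_add_le _ _
  · rw [act_smul, norm_smul]
  · linarith [norm_nonneg C, norm_nonneg C⁻¹]
  · refine (norm_le_of_isUnit hC x).trans ?_
    change _ ≤ _ * ‖act C x‖
    gcongr
    linarith [norm_nonneg C]
  · refine (norm_act_le C x).trans ?_
    gcongr
    linarith [norm_nonneg C⁻¹]

/-- The Lyapunov inequality `Fᵀ P F < ρ P` makes `F` a contraction for the norm of `P`. -/
theorem seminorm_act_le {P F : Matrix (Fin p) (Fin p) ℝ} {ρ : ℝ} (hρ : 0 ≤ ρ)
    {N : Seminorm ℝ (EuclideanSpace ℝ (Fin p))} (hN : ∀ x, N x ^ 2 = quad P x)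
    (h : (ρ • P - Fᵀ * P * F).PosDef) (x : EuclideanSpace ℝ (Fin p)) :
    N (act F x) ≤ √ρ * N x := by
  have h1 : quad P (act F x) ≤ ρ * quad P x := by
    by_cases hx : x = 0
    · simp [hx, quad, act]
    · have := quad_pos h hx
      rw [quad_sub, quad_smul, quad_transpose_mul_mul] at this
      linarith
  rw [← hN, ← hN] at h1
  refine le_of_sq_le_sq ?_ (by have : 0 ≤ N x := apply_nonneg _ _; positivity)
  rwa [mul_pow, Real.sq_sqrt hρ]

/-- The solution of the Riccati equation is a common Lyapunov matrix for the optimal closed loop,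
for small perturbations of it, and for high powers of a stable fallback closed loop. -/
theorem exists_eventually_commonLyapunov {n m : ℕ} {A : Matrix (Fin n) (Fin n) ℝ}
    {B : Matrix (Fin n) (Fin m) ℝ} {Q : Matrix (Fin n) (Fin n) ℝ} {R : Matrix (Fin m) (Fin m) ℝ}
    {P : Matrix (Fin n) (Fin n) ℝ} (hQ : Q.PosDef) (hR : R.PosDef)
    (hP : IsRiccatiSolution A B Q R P) {K₀ : Matrix (Fin m) (Fin n) ℝ}
    (hK₀ : IsSchurStable (A + B * K₀)) {K₁ : ℕ → Matrix (Fin m) (Fin n) ℝ}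
    (hK₁ : Tendsto K₁ atTop (𝓝 (lqrGain A B R P))) :
    ∃ (ρ : ℝ) (t₀ : ℕ), 0 < ρ ∧ ρ < 1 ∧
      ∀ᶠ k in atTop, ∀ s : ℕ, t₀ ≤ s → CommonLyapunov A B (K₁ k) K₀ ρ P s := by
  have hPt : P.IsHermitian := hP.1.isHermitian
  have hherm : ∀ (ρ : ℝ) (F : Matrix (Fin n) (Fin n) ℝ), (ρ • P - Fᵀ * P * F).IsHermitian := by
    intro ρ F
    refine Matrix.IsHermitian.sub ?_ ?_
    · exact hPt.smul (IsSelfAdjoint.all ρ)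
    · simpa using Matrix.isHermitian_conjTranspose_mul_mul F hPt
  obtain ⟨F, hF⟩ : ∃ F, F = A + B * lqrGain A B R P := ⟨_, rfl⟩
  have hlim : (P - Fᵀ * P * F).PosDef := by
    rw [hF, hP.sub_closedLoop hR]
    refine hQ.add_posSemidef ?_
    simpa using hR.posSemidef.conjTranspose_mul_mul_same (lqrGain A B R P)
  have hρ : ∀ᶠ ρ in 𝓝[<] (1 : ℝ), (ρ • P - Fᵀ * P * F).PosDef := by
    refine eventually_posDef hlim ?_ fun ρ => hherm ρ F
    have hc : Continuous fun ρ : ℝ => ρ • P - Fᵀ * P * F := by fun_prop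
    have := hc.tendsto 1
    rw [one_smul] at this
    exact this.mono_left nhdsWithin_le_nhds
  have hρ0 : ∀ᶠ ρ in 𝓝[<] (1 : ℝ), 0 < ρ :=
    nhdsWithin_le_nhds (lt_mem_nhds one_pos)
  obtain ⟨ρ, ⟨hρP, hρ0⟩, hρ1⟩ := ((hρ.and hρ0).and self_mem_nhdsWithin).exists
  have h1 : ∀ᶠ k in atTop, (ρ • P - (A + B * K₁ k)ᵀ * P * (A + B * K₁ k)).PosDef := by
    refine eventually_posDef hρP ?_ fun k => hherm ρ _
    have hc : Continuous fun K : Matrix (Fin m) (Fin n) ℝ =>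
        ρ • P - (A + B * K)ᵀ * P * (A + B * K) := by fun_prop
    rw [hF]
    exact (hc.tendsto _).comp hK₁
  have h2 : ∀ᶠ s : ℕ in atTop,
      (ρ • P - ((A + B * K₀) ^ s)ᵀ * P * (A + B * K₀) ^ s).PosDef := by
    refine eventually_posDef (hP.1.smul hρ0) ?_ fun s => hherm ρ _
    have hc : Continuous fun K : Matrix (Fin n) (Fin n) ℝ => ρ • P - Kᵀ * P * K := by fun_prop
    have h := (hc.tendsto 0).comp (tendsto_pow_of_isSchurStable hK₀)
    rwa [Matrix.mul_zero, sub_zero] at h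
  obtain ⟨t₀, ht₀⟩ := eventually_atTop.1 h2
  exact ⟨ρ, t₀, hρ0, hρ1, h1.mono fun k hk s hs => ⟨hk, ht₀ s hs⟩⟩

end Matrices

section Gap

open scoped Matrix.Norms.L2Operator

variable {n m : ℕ} {A : Matrix (Fin n) (Fin n) ℝ} {B : Matrix (Fin n) (Fin m) ℝ}
  {Q : Matrix (Fin n) (Fin n) ℝ} {R : Matrix (Fin m) (Fin m) ℝ} {K₀ K₁ : Matrix (Fin m) (Fin n) ℝ}

/-! ### Comparison of the two closed loops -/

theorem isSwitchedPath_closedLoop (A : Matrix (Fin n) (Fin n) ℝ) (B : Matrix (Fin n) (Fin m) ℝ)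
    (K₁ K₀ : Matrix (Fin m) (Fin n) ℝ) (M : ℝ) (t : ℕ) (w : ℕ → EuclideanSpace ℝ (Fin n)) :
    IsSwitchedPath (act (A + B * K₀)) (act (A + B * K₁)) M t w
      (fun k => (closedLoop A B (switchedController K₁ K₀ M t) w k).1)
      (fun k => (closedLoop A B (switchedController K₁ K₀ M t) w k).2) where
  zero := rfl
  counter_zero := rfl
  step k := by
    simp only [closedLoop, act_add_left, act_mul]
    generalize closedLoop A B (switchedController K₁ K₀ M t) w k = y
    simp only [switchedController]
    by_cases h1 : 0 < y.2
    · simp [h1]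
    · by_cases h2 : M ≤ ‖y.1‖
      · simp [h2, Nat.eq_zero_of_not_pos h1]
      · simp [h2, Nat.eq_zero_of_not_pos h1, not_le.1 h2]

theorem switchedController_fst (K₁ K₀ : Matrix (Fin m) (Fin n) ℝ) (M : ℝ) (t : ℕ)
    (x : EuclideanSpace ℝ (Fin n)) (ξ : ℕ) : (switchedController K₁ K₀ M t x ξ).1 =
      if 0 < ξ ∨ M ≤ ‖x‖ then act K₀ x else act K₁ x := by
  unfold switchedController
  by_cases h1 : 0 < ξ <;> by_cases h2 : M ≤ ‖x‖ <;> simp [h1, h2]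

theorem abs_stageCost_switched_le {G M : ℝ} {t : ℕ} (hG : 1 ≤ G) (hQ : ‖Q‖ ≤ G) (hR : ‖R‖ ≤ G)
    (hK₀ : ‖K₀‖ ≤ G) (hK₁ : ‖K₁‖ ≤ G) (w : ℕ → EuclideanSpace ℝ (Fin n)) (k : ℕ) :
    |stageCost A B Q R (switchedController K₁ K₀ M t) w k| ≤
      2 * G ^ 3 * ‖(closedLoop A B (switchedController K₁ K₀ M t) w k).1‖ ^ 2 := by
  simp only [stageCost]
  generalize closedLoop A B (switchedController K₁ K₀ M t) w k = y
  have hu : ‖(switchedController K₁ K₀ M t y.1 y.2).1‖ ≤ G * ‖y.1‖ := by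
    rw [switchedController_fst]
    split_ifs
    · exact (norm_act_le _ _).trans (by gcongr)
    · exact (norm_act_le _ _).trans (by gcongr)
  calc _ ≤ |quad Q y.1| + |quad R (switchedController K₁ K₀ M t y.1 y.2).1| := abs_add_le _ _
    _ ≤ G * ‖y.1‖ ^ 2 + G * (G * ‖y.1‖) ^ 2 := by
        gcongr
        · exact (abs_quad_le _ _).trans (by gcongr)
        · exact (abs_quad_le _ _).trans (by gcongr)
    _ = G * ‖y.1‖ ^ 2 + G ^ 3 * ‖y.1‖ ^ 2 := by ring
    _ ≤ G ^ 3 * ‖y.1‖ ^ 2 + G ^ 3 * ‖y.1‖ ^ 2 := by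
        gcongr
        exact le_self_pow₀ hG (by norm_num)
    _ = _ := by ring

/-- The stage costs of the two closed loops differ by the deviation of the trajectories, and by
the different input while the fallback is active. -/
theorem abs_stageCost_sub_le_deviation {G M : ℝ} {t : ℕ} (hG : 1 ≤ G) (hQ : ‖Q‖ ≤ G)
    (hR : ‖R‖ ≤ G) (hK₀ : ‖K₀‖ ≤ G) (hK₁ : ‖K₁‖ ≤ G) (w : ℕ → EuclideanSpace ℝ (Fin n)) (k : ℕ)
    {z x : EuclideanSpace ℝ (Fin n)} {ξ : ℕ}
    (hz : closedLoop A B (switchedController K₁ K₀ M t) w k = (z, ξ))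
    (hx : (closedLoop A B (linearController K₁) w k).1 = x) :
    |stageCost A B Q R (switchedController K₁ K₀ M t) w k -
        stageCost A B Q R (linearController K₁) w k| ≤
      2 * G ^ 3 * (2 * ‖z‖ * ‖z - x‖ + ‖z - x‖ ^ 2 +
        if 0 < ξ ∨ M ≤ ‖z‖ then ‖z‖ ^ 2 else 0) := by
  simp only [stageCost, hz, hx, linearController, switchedController_fst]
  have hG0 : 0 < G := by linarith
  have hGG : G ≤ G ^ 3 := le_self_pow₀ hG (by norm_num)
  have hxz : ‖x‖ ≤ ‖z‖ + ‖z - x‖ := by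
    have := norm_sub_le z (z - x); rwa [sub_sub_cancel] at this
  have h1 : |quad Q z - quad Q x| ≤ G * (2 * ‖z‖ * ‖z - x‖ + ‖z - x‖ ^ 2) := by
    refine (abs_quad_sub_quad_le Q z x).trans ?_
    calc _ ≤ G * (‖z‖ + (‖z‖ + ‖z - x‖)) * ‖z - x‖ := by gcongr
      _ = _ := by ring
  have h2 : |quad R (act K₁ z) - quad R (act K₁ x)| ≤
      G ^ 3 * (2 * ‖z‖ * ‖z - x‖ + ‖z - x‖ ^ 2) := by
    refine (abs_quad_sub_quad_le R _ _).trans ?_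
    rw [← act_sub]
    calc _ ≤ G * (G * ‖z‖ + G * (‖z‖ + ‖z - x‖)) * (G * ‖z - x‖) := by
          gcongr
          · exact (norm_act_le _ _).trans (by gcongr)
          · exact (norm_act_le _ _).trans (by gcongr)
          · exact (norm_act_le _ _).trans (by gcongr)
      _ = _ := by ring
  have h4 : ∀ K : Matrix (Fin m) (Fin n) ℝ, ‖K‖ ≤ G → |quad R (act K z)| ≤ G ^ 3 * ‖z‖ ^ 2 := by
    intro K hK
    calc _ ≤ ‖R‖ * ‖act K z‖ ^ 2 := abs_quad_le _ _
      _ ≤ G * (G * ‖z‖) ^ 2 := by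
          gcongr
          exact (norm_act_le _ _).trans (by gcongr)
      _ = _ := by ring
  have hd : 0 ≤ 2 * ‖z‖ * ‖z - x‖ + ‖z - x‖ ^ 2 := by positivity
  have h5 := mul_le_mul_of_nonneg_right hGG hd
  rw [abs_le] at h1 h2 ⊢
  have h60 := abs_le.1 (h4 K₀ hK₀)
  have h61 := abs_le.1 (h4 K₁ hK₁)
  split_ifs <;> constructor <;> nlinarith

/-- The deviation of the switched trajectory from the linear one is driven by the fallback phases
only. -/
theorem sq_norm_deviation_le {N : Seminorm ℝ (EuclideanSpace ℝ (Fin n))} {c r G a M lam : ℝ}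
    {t : ℕ} (hc : 1 ≤ c) (hr : 0 ≤ r) (hr1 : r < 1) (hG : 1 ≤ G) (ha : 1 ≤ a)
    (hBK : ‖B * (K₀ - K₁)‖ ≤ G) (hN : ∀ x, N x ≤ c * ‖x‖) (hN' : ∀ x, ‖x‖ ≤ c * N x)
    (hcontr : ∀ x, N (act (A + B * K₁) x) ≤ r * N x) (ht : 1 ≤ t) (hlam : 0 ≤ lam)
    (w : ℕ → EuclideanSpace ℝ (Fin n)) {S : ℕ → ℝ} (hS : ∀ k, 0 ≤ S k)
    (hz : ∀ k, ‖(closedLoop A B (switchedController K₁ K₀ M t) w k).1‖ ≤ a * S k) (k : ℕ) :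
    ‖(closedLoop A B (switchedController K₁ K₀ M t) w k).1 -
        (closedLoop A B (linearController K₁) w k).1‖ ^ 2 ≤
      c ^ 4 * G ^ 2 * a ^ 2 * discountedSum r (1 - r)⁻¹ (excursion lam a M t S) k := by
  have hc0 : 0 < c := by linarith
  have hG0 : 0 < G := by linarith
  have ha0 : 0 < a := by linarith
  obtain ⟨z, hzd⟩ : ∃ z : ℕ → EuclideanSpace ℝ (Fin n),
      z = fun k => (closedLoop A B (switchedController K₁ K₀ M t) w k).1 := ⟨_, rfl⟩
  obtain ⟨ξ, hξd⟩ : ∃ ξ : ℕ → ℕ,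
      ξ = fun k => (closedLoop A B (switchedController K₁ K₀ M t) w k).2 := ⟨_, rfl⟩
  obtain ⟨x, hxd⟩ : ∃ x : ℕ → EuclideanSpace ℝ (Fin n),
      x = fun k => (closedLoop A B (linearController K₁) w k).1 := ⟨_, rfl⟩
  have hpath : IsSwitchedPath (act (A + B * K₀)) (act (A + B * K₁)) M t w z ξ := by
    rw [hzd, hξd]; exact isSwitchedPath_closedLoop A B K₁ K₀ M t w
  have hz' : ∀ k, ‖z k‖ ≤ a * S k := fun k => by rw [hzd]; exact hz k
  have hexc := hpath.sq_le_excursion ht hlam hS hz'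
  have hx0 : x 0 = 0 := by rw [hxd]; rfl
  have hxs : ∀ k, x (k + 1) = act (A + B * K₁) (x k) + w k := fun k => by
    rw [hxd]; simp [closedLoop, linearController, act_add_left, act_mul]
  have hgoal : ‖z k - x k‖ ^ 2 ≤
      c ^ 4 * G ^ 2 * a ^ 2 * discountedSum r (1 - r)⁻¹ (excursion lam a M t S) k := by
    obtain ⟨b, hb⟩ : ∃ b, b = c * G * a := ⟨_, rfl⟩
    have hb0 : 0 < b := by rw [hb]; positivity
    obtain ⟨e, he⟩ : ∃ e : ℕ → ℝ, e = fun k => if 0 < ξ k ∨ M ≤ ‖z k‖ then S k else 0 := ⟨_, rfl⟩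
    have hstep : ∀ k, N (z (k + 1) - x (k + 1)) ≤ r * N (z k - x k) + b * e k := by
      have hfb : ∀ k, (0 < ξ k ∨ M ≤ ‖z k‖) → z (k + 1) = act (A + B * K₀) (z k) + w k →
          N (z (k + 1) - x (k + 1)) ≤ r * N (z k - x k) + b * e k := by
        intro k hk hzk
        have e1 : z (k + 1) - x (k + 1) =
            act (A + B * K₁) (z k - x k) + act (B * (K₀ - K₁)) (z k) := by
          rw [hzk, hxs, act_sub, Matrix.mul_sub, act_sub_left, act_add_left, act_add_left,
            act_add_left]
          abel
        rw [e1]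
        refine (map_add_le_add _ _ _).trans (add_le_add (hcontr _) ?_)
        rw [he]
        simp only [hk, if_true]
        calc N (act (B * (K₀ - K₁)) (z k)) ≤ c * (‖B * (K₀ - K₁)‖ * ‖z k‖) :=
              (hN _).trans (by gcongr; exact norm_act_le _ _)
          _ ≤ c * (G * (a * S k)) := by gcongr; exact hz' k
          _ = b * S k := by rw [hb]; ring
      intro k
      rcases hpath.step k with ⟨h1, h2, -⟩ | ⟨-, h1, h2, -⟩ | ⟨h0, h1, h2, -⟩
      · exact hfb k (Or.inl h1) h2
      · exact hfb k (Or.inr h1) h2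
      · have e1 : z (k + 1) - x (k + 1) = act (A + B * K₁) (z k - x k) := by
          rw [h2, hxs, act_sub]; abel
        have e2 : e k = 0 := by rw [he]; simp [h0, h1]
        rw [e1, e2]
        simpa using hcontr (z k - x k)
    have hsq := sq_le_discountedSum (x := fun k => N (z k - x k) / b) (e := e)
      (v := excursion lam a M t S) hr hr1
      (fun k => div_nonneg (apply_nonneg _ _) hb0.le) (by simp [hx0, hpath.zero])
      (fun k => by
        rw [div_le_iff₀ hb0]
        refine (hstep k).trans (le_of_eq ?_)
        field_simp)
      (fun k => by
        rw [he]
        by_cases hk : 0 < ξ k ∨ M ≤ ‖z k‖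
        · simpa only [hk, if_true] using hexc k hk
        · simpa only [hk, if_false, zero_pow two_ne_zero] using excursion_nonneg _ _ _ _ _ _) k
    rw [div_pow, div_le_iff₀ (by positivity)] at hsq
    calc ‖z k - x k‖ ^ 2 ≤ (c * N (z k - x k)) ^ 2 :=
          pow_le_pow_left₀ (norm_nonneg _) (hN' _) 2
      _ = c ^ 2 * N (z k - x k) ^ 2 := by ring
      _ ≤ c ^ 2 * (discountedSum r (1 - r)⁻¹ (excursion lam a M t S) k * b ^ 2) := by gcongr
      _ = _ := by rw [hb]; ring
  rw [hzd, hxd] at hgoal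
  exact hgoal

/-- A pathwise bound for the difference of the stage costs in terms of the noise envelope `S`. The
weight `θ` balances the cross term between the state, which is of order one, and the deviation,
which is small in mean square. -/
theorem abs_stageCost_sub_le {N : Seminorm ℝ (EuclideanSpace ℝ (Fin n))} {c r G a M lam θ : ℝ}
    {t : ℕ} (hc : 1 ≤ c) (hr : 0 ≤ r) (hr1 : r < 1) (hG : 1 ≤ G) (ha : 1 ≤ a)
    (hQ : ‖Q‖ ≤ G) (hR : ‖R‖ ≤ G) (hK₀ : ‖K₀‖ ≤ G) (hK₁ : ‖K₁‖ ≤ G)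
    (hBK : ‖B * (K₀ - K₁)‖ ≤ G) (hN : ∀ x, N x ≤ c * ‖x‖) (hN' : ∀ x, ‖x‖ ≤ c * N x)
    (hcontr : ∀ x, N (act (A + B * K₁) x) ≤ r * N x) (ht : 1 ≤ t) (hlam : 0 ≤ lam) (hθ : 0 < θ)
    (w : ℕ → EuclideanSpace ℝ (Fin n)) {S : ℕ → ℝ} (hS : ∀ k, 0 ≤ S k)
    (hz : ∀ k, ‖(closedLoop A B (switchedController K₁ K₀ M t) w k).1‖ ≤ a * S k) (k : ℕ) :
    |stageCost A B Q R (switchedController K₁ K₀ M t) w k -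
        stageCost A B Q R (linearController K₁) w k| ≤
      4 * G ^ 3 * (c ^ 4 * G ^ 2 * a ^ 2) *
        ((1 + θ⁻¹) * discountedSum r (1 - r)⁻¹ (excursion lam a M t S) k +
          θ * Real.exp (S k) + excursion lam a M t S k) := by
  have hdev := sq_norm_deviation_le hc hr hr1 hG ha hBK hN hN' hcontr ht hlam w hS hz k
  have hexc := (isSwitchedPath_closedLoop A B K₁ K₀ M t w).sq_le_excursion ht hlam hS hz k
  refine (abs_stageCost_sub_le_deviation hG hQ hR hK₀ hK₁ w k rfl rfl).trans ?_
  have hzk := hz k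
  generalize (closedLoop A B (switchedController K₁ K₀ M t) w k) = y at *
  generalize (closedLoop A B (linearController K₁) w k).1 = x at *
  obtain ⟨D, hD⟩ : ∃ D, D = discountedSum r (1 - r)⁻¹ (excursion lam a M t S) k := ⟨_, rfl⟩
  obtain ⟨X, hX⟩ : ∃ X, X = excursion lam a M t S k := ⟨_, rfl⟩
  obtain ⟨C, hC⟩ : ∃ C, C = c ^ 4 * G ^ 2 * a ^ 2 := ⟨_, rfl⟩
  have hX0 : 0 ≤ X := by rw [hX]; exact excursion_nonneg _ _ _ _ _ _
  have hD0 : 0 ≤ D := by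
    rw [hD]
    exact discountedSum_nonneg hr (inv_nonneg.2 (by linarith)) (excursion_nonneg _ _ _ _ _) k
  rw [← hD, ← hC] at hdev ⊢
  rw [← hX] at hexc ⊢
  have haC : a ^ 2 ≤ C := by
    rw [hC]
    have h1 : 1 ≤ c ^ 4 := one_le_pow₀ hc
    have h2 : 1 ≤ G ^ 2 := one_le_pow₀ hG
    have h3 : 1 ≤ c ^ 4 * G ^ 2 := one_le_mul_of_one_le_of_one_le h1 h2
    exact le_mul_of_one_le_left (by positivity) h3
  have hC0 : 0 < C := lt_of_lt_of_le (by positivity) haC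
  have hsq : ‖y.1‖ ^ 2 ≤ C * S k ^ 2 := by
    calc ‖y.1‖ ^ 2 ≤ (a * S k) ^ 2 := pow_le_pow_left₀ (norm_nonneg _) hzk 2
      _ = a ^ 2 * S k ^ 2 := by ring
      _ ≤ _ := by gcongr
  have hexp : S k ^ 2 ≤ 2 * Real.exp (S k) := by
    linarith [Real.quadratic_le_exp_of_nonneg (hS k), hS k]
  -- weighted arithmetic-geometric mean inequality, with weight `θ`
  have hmean : 2 * ‖y.1‖ * ‖y.1 - x‖ ≤ θ * ‖y.1‖ ^ 2 + θ⁻¹ * ‖y.1 - x‖ ^ 2 := by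
    have h : θ * ‖y.1‖ ^ 2 + θ⁻¹ * ‖y.1 - x‖ ^ 2 - 2 * ‖y.1‖ * ‖y.1 - x‖ =
        θ⁻¹ * (θ * ‖y.1‖ - ‖y.1 - x‖) ^ 2 := by field_simp; ring
    have h' : 0 ≤ θ⁻¹ * (θ * ‖y.1‖ - ‖y.1 - x‖) ^ 2 := by positivity
    linarith
  have h1 : θ * ‖y.1‖ ^ 2 ≤ 2 * C * (θ * Real.exp (S k)) := by
    calc θ * ‖y.1‖ ^ 2 ≤ θ * (C * (2 * Real.exp (S k))) := by
          gcongr; exact hsq.trans (by gcongr)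
      _ = _ := by ring
  have h2 : (1 + θ⁻¹) * ‖y.1 - x‖ ^ 2 ≤ (1 + θ⁻¹) * (C * D) := by gcongr
  have h3 : (if 0 < y.2 ∨ M ≤ ‖y.1‖ then ‖y.1‖ ^ 2 else 0) ≤ C * X := by
    split_ifs with h
    · exact hsq.trans (by gcongr; exact hexc h)
    · positivity
  have h4 : 0 ≤ (1 + θ⁻¹) * (C * D) := by positivity
  have h5 : 0 ≤ C * X := by positivity
  calc _ ≤ 2 * G ^ 3 * (2 * ((1 + θ⁻¹) * (C * D)) + 2 * C * (θ * Real.exp (S k)) +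
        2 * (C * X)) := mul_le_mul_of_nonneg_left (by linarith) (by positivity)
    _ = _ := by ring

/-! ### Comparison of costs -/

variable {Ω : Type*} [MeasurableSpace Ω] {μ : Measure Ω}

theorem lintegral_sum_le {f g h : ℕ → Ω → ℝ} {K : ℝ} (hfg : ∀ k ω, f k ω ≤ g k ω + h k ω)
    (hh : ∀ k ω, 0 ≤ h k ω) (hK : ∀ k, IntegralLE μ (h k) K) (T : ℕ) :
    ∫⁻ ω, ENNReal.ofReal (∑ k ∈ Finset.range T, f k ω) ∂μ ≤
      ∫⁻ ω, ENNReal.ofReal (∑ k ∈ Finset.range T, g k ω) ∂μ + ENNReal.ofReal K * T := by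
  have hsum := IntegralLE.sum (Finset.range T) hK
  calc _ ≤ ∫⁻ ω, (ENNReal.ofReal (∑ k ∈ Finset.range T, g k ω) +
        ENNReal.ofReal (∑ k ∈ Finset.range T, h k ω)) ∂μ := by
        refine lintegral_mono fun ω => ?_
        refine (ENNReal.ofReal_le_ofReal ?_).trans ENNReal.ofReal_add_le
        rw [← Finset.sum_add_distrib]
        exact Finset.sum_le_sum fun k _ => hfg k ω
    _ = ∫⁻ ω, ENNReal.ofReal (∑ k ∈ Finset.range T, g k ω) ∂μ +
        ∫⁻ ω, ENNReal.ofReal (∑ k ∈ Finset.range T, h k ω) ∂μ :=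
        lintegral_add_right' _ hsum.1.aemeasurable.ennreal_ofReal
    _ ≤ _ := by
        gcongr
        rw [← ofReal_integral_eq_lintegral_ofReal hsum.1
          (Eventually.of_forall fun ω => Finset.sum_nonneg fun k _ => hh k ω)]
        refine (ENNReal.ofReal_le_ofReal hsum.2).trans (le_of_eq ?_)
        rw [Finset.card_range, mul_comm, ENNReal.ofReal_mul' (Nat.cast_nonneg T),
          ENNReal.ofReal_natCast]

variable {w : ℕ → Ω → EuclideanSpace ℝ (Fin n)}

theorem lqCost_le_add {c c' : Controller n m} {h : ℕ → Ω → ℝ} {K : ℝ}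
    (hcc : ∀ k ω, stageCost A B Q R c (fun j => w j ω) k ≤
      stageCost A B Q R c' (fun j => w j ω) k + h k ω)
    (hh : ∀ k ω, 0 ≤ h k ω) (hK : ∀ k, IntegralLE μ (h k) K) :
    lqCost A B Q R μ w c ≤ lqCost A B Q R μ w c' + ENNReal.ofReal K := by
  unfold lqCost
  rw [← limsup_add_const atTop _ _ (by isBoundedDefault) (by isBoundedDefault)]
  refine limsup_le_limsup (Eventually.of_forall fun T => ?_)
  refine (ENNReal.div_le_div_right (lintegral_sum_le hcc hh hK T) _).trans ?_
  rw [ENNReal.add_div]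
  exact add_le_add le_rfl (ENNReal.div_le_of_le_mul le_rfl)

theorem lqCost_le {c : Controller n m} {h : ℕ → Ω → ℝ} {K : ℝ}
    (hc : ∀ k ω, stageCost A B Q R c (fun j => w j ω) k ≤ h k ω)
    (hh : ∀ k ω, 0 ≤ h k ω) (hK : ∀ k, IntegralLE μ (h k) K) :
    lqCost A B Q R μ w c ≤ ENNReal.ofReal K := by
  refine (limsup_le_limsup (v := fun _ => ENNReal.ofReal K)
    (Eventually.of_forall fun T => ?_)).trans (limsup_const _).le
  refine ENNReal.div_le_of_le_mul ?_
  simpa using lintegral_sum_le (g := fun _ _ => 0) (fun k ω => by simpa using hc k ω) hh hK T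

theorem exists_integralLE_exp_discountedSum [IsProbabilityMeasure μ] {ν : Measure _} [IsGaussian ν]
    (hw : ∀ k, HasLaw (w k) ν μ) {s : ℝ} (hs : 0 ≤ s) (hs1 : s < 1) (b lam : ℝ) :
    ∃ K : ℝ, 1 ≤ K ∧ ∀ k, IntegralLE μ
      (fun ω => Real.exp (lam * discountedSum s b (fun j => ‖w j ω‖) k)) K := by
  have h1 : 0 < 1 - s := by linarith
  have hint := integrable_exp_mul_norm_of_isGaussian ν (lam * b / (1 - s))
  refine ⟨max 1 (∫ x, Real.exp (lam * b / (1 - s) * ‖x‖) ∂ν), le_max_left _ _, fun k => ?_⟩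
  refine integralLE_exp_discountedSum (v := fun k ω => ‖w k ω‖) hs hs1 (le_max_left _ _)
    (fun k => (hw k).aemeasurable.norm) (fun k => ⟨?_, ?_⟩) k
  · rw [← (hw k).map_eq] at hint
    exact hint.comp_aemeasurable (hw k).aemeasurable
  · refine le_trans (le_of_eq ?_) (le_max_right _ _)
    rw [← (hw k).map_eq] at hint ⊢
    exact (integral_map (hw k).aemeasurable hint.1).symm

/-- The costs of the switched strategy and of its primary linear feedback differ by
`O ((t + 1) * exp (-(lam * M / 2)))` for every rate `lam`, uniformly in the primary gain, as long
as the primary closed loop contracts a fixed norm at a fixed rate. -/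
theorem exists_lqCost_gap [IsProbabilityMeasure μ] {ν : Measure _} [IsGaussian ν]
    (hw : ∀ k, HasLaw (w k) ν μ) {N₀ N₁ : Seminorm ℝ (EuclideanSpace ℝ (Fin n))} {c r G lam : ℝ}
    (hc : 1 ≤ c) (hr : 0 < r) (hr1 : r < 1) (hG : 1 ≤ G)
    (hQ : ‖Q‖ ≤ G) (hR : ‖R‖ ≤ G) (hK₀ : ‖K₀‖ ≤ G)
    (hN₀ : ∀ x, N₀ x ≤ c * ‖x‖) (hN₀' : ∀ x, ‖x‖ ≤ c * N₀ x)
    (hN₁ : ∀ x, N₁ x ≤ c * ‖x‖) (hN₁' : ∀ x, ‖x‖ ≤ c * N₁ x)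
    (hf₀ : ∀ x, N₀ (act (A + B * K₀) x) ≤ r * N₀ x) (hlam : 0 ≤ lam) :
    ∃ (C : ℝ) (t₁ : ℕ), 0 ≤ C ∧ ∀ (K₁ : Matrix (Fin m) (Fin n) ℝ) (M : ℝ) (t : ℕ), 0 ≤ M → t₁ ≤ t →
      ‖K₁‖ ≤ G → ‖B * (K₀ - K₁)‖ ≤ G → (∀ x, N₁ (act (A + B * K₁) x) ≤ r * N₁ x) →
      lqCost A B Q R μ w (switchedController K₁ K₀ M t) ≤ ENNReal.ofReal C ∧
      lqCost A B Q R μ w (switchedController K₁ K₀ M t) ≤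
        lqCost A B Q R μ w (linearController K₁) +
          ENNReal.ofReal (C * ((t + 1) * Real.exp (-(lam * M / 2)))) ∧
      lqCost A B Q R μ w (linearController K₁) ≤
        lqCost A B Q R μ w (switchedController K₁ K₀ M t) +
          ENNReal.ofReal (C * ((t + 1) * Real.exp (-(lam * M / 2)))) := by
  obtain ⟨s, hs⟩ : ∃ s, s = (1 + r) / 2 := ⟨_, rfl⟩
  have hs0 : 0 < s := by rw [hs]; linarith
  have hs1 : s < 1 := by rw [hs]; linarith
  have hrs : r < s := by rw [hs]; linarith
  have hq1 : r / s < 1 := (div_lt_one hs0).2 hrs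
  have hq0 : 0 ≤ r / s := by positivity
  have hc0 : 0 < c := by linarith
  have hG0 : 0 < G := by linarith
  have hr1' : 0 < 1 - r := by linarith
  obtain ⟨a, ha⟩ : ∃ a, a = c ^ 3 := ⟨_, rfl⟩
  have ha1 : 1 ≤ a := by rw [ha]; exact one_le_pow₀ hc
  have ha0 : 0 < a := by linarith
  -- long dwell times pay for exchanging the two norms
  have hev : ∀ᶠ t : ℕ in atTop, (c ^ 2) ^ 2 * (r / s) ^ t ≤ 1 := by
    have h := (tendsto_pow_atTop_nhds_zero_of_lt_one hq0 hq1).const_mul ((c ^ 2) ^ 2)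
    rw [mul_zero] at h
    exact h.eventually (ge_mem_nhds one_pos)
  obtain ⟨t₁, ht₁⟩ := eventually_atTop.1 (hev.and (eventually_ge_atTop 1))
  obtain ⟨k1, hk1, hm1⟩ := exists_integralLE_exp_discountedSum hw hs0.le hs1 a (2 * lam * a)
  obtain ⟨k2, hk2, hm2⟩ := exists_integralLE_exp_discountedSum hw hs0.le hs1 a 2
  obtain ⟨k3, hk3, hm3⟩ := exists_integralLE_exp_discountedSum hw hs0.le hs1 a 1
  obtain ⟨K, hK⟩ : ∃ K, K = k1 + k2 + k3 := ⟨_, rfl⟩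
  have hK0 : 0 ≤ K := by rw [hK]; linarith
  obtain ⟨S, hS⟩ : ∃ S : Ω → ℕ → ℝ, S = fun ω => discountedSum s a (fun j => ‖w j ω‖) := ⟨_, rfl⟩
  have hm1 : ∀ k, IntegralLE μ (fun ω => Real.exp (2 * lam * a * S ω k)) K := fun k => by
    rw [hS]; exact (hm1 k).mono (by linarith)
  have hm2 : ∀ k, IntegralLE μ (fun ω => Real.exp (2 * S ω k)) K := fun k => by
    rw [hS]; exact (hm2 k).mono (by linarith)
  have hm3 : ∀ k, IntegralLE μ (fun ω => Real.exp (S ω k)) K := fun k => by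
    rw [hS]; simpa using (hm3 k).mono (by linarith : k3 ≤ K)
  have hS0 : ∀ ω k, 0 ≤ S ω k := fun ω k => by
    rw [hS]; exact discountedSum_nonneg hs0.le ha0.le (fun _ => norm_nonneg _) k
  obtain ⟨C₁, hC₁⟩ : ∃ C₁, C₁ = 4 * G ^ 3 * (c ^ 4 * G ^ 2 * a ^ 2) := ⟨_, rfl⟩
  have hC₁0 : 0 < C₁ := by rw [hC₁]; positivity
  obtain ⟨L, hL⟩ : ∃ L, L = (1 - r)⁻¹ / (1 - r) := ⟨_, rfl⟩
  have hL0 : 0 < L := by rw [hL]; positivity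
  obtain ⟨C, hC⟩ : ∃ C, C = C₁ * (K * (4 * L + 3)) + 2 * G ^ 3 * (a ^ 2 * 2) * K := ⟨_, rfl⟩
  have hCle1 : C₁ * (K * (4 * L + 3)) ≤ C := by
    rw [hC]; exact le_add_of_nonneg_right (by positivity)
  have hCle2 : 2 * G ^ 3 * (a ^ 2 * 2) * K ≤ C := by
    rw [hC]; exact le_add_of_nonneg_left (by positivity)
  refine ⟨C, t₁, by rw [hC]; positivity, fun K₁ M t hM ht hK₁ hBK hf₁ => ?_⟩
  obtain ⟨hqt, ht1⟩ := ht₁ t ht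
  obtain ⟨θ, hθ⟩ : ∃ θ, θ = Real.exp (-(lam * M / 2)) := ⟨_, rfl⟩
  have hθ0 : 0 < θ := by rw [hθ]; exact Real.exp_pos _
  have hθ1 : θ ≤ 1 := by
    rw [hθ]
    refine Real.exp_le_one_iff.2 ?_
    have : 0 ≤ lam * M := mul_nonneg hlam hM
    linarith
  have hθ2 : Real.exp (-(lam * M)) = θ ^ 2 := by
    rw [hθ, ← Real.exp_nat_mul]; congr 1; push_cast; ring
  have hz : ∀ ω k, ‖(closedLoop A B (switchedController K₁ K₀ M t) (fun j => w j ω) k).1‖ ≤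
      a * S ω k := fun ω k => by
    have := (isSwitchedPath_closedLoop A B K₁ K₀ M t (fun j => w j ω)).norm_le ht1 hc hq0 hq1.le hs0
      (div_mul_cancel₀ r hs0.ne') hrs.le hN₀ hN₀' hN₁ hN₁' hf₀ hf₁ hqt k
    rw [hS, ha]
    exact this
  obtain ⟨g, hg⟩ : ∃ g : ℕ → Ω → ℝ, g = fun k ω =>
      C₁ * ((1 + θ⁻¹) * discountedSum r (1 - r)⁻¹ (fun j => excursion lam a M t (S ω) j) k +
        θ * Real.exp (S ω k) + excursion lam a M t (S ω) k) := ⟨_, rfl⟩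
  have hgap : ∀ k ω, |stageCost A B Q R (switchedController K₁ K₀ M t) (fun j => w j ω) k -
      stageCost A B Q R (linearController K₁) (fun j => w j ω) k| ≤ g k ω := fun k ω => by
    rw [hg, hC₁]
    exact abs_stageCost_sub_le hc hr.le hr1 hG ha1 hQ hR hK₀ hK₁ hBK hN₁ hN₁' hf₁ ht1 hlam hθ0
      (fun j => w j ω) (hS0 ω) (hz ω) k
  have hg0 : ∀ k ω, 0 ≤ g k ω := fun k ω => (abs_nonneg _).trans (hgap k ω)
  have hgI : ∀ k, IntegralLE μ (g k) (C * ((t + 1) * θ)) := by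
    intro k
    have hX := integralLE_excursion (M := M) (t := t) hm1 hm2
    have hX0 : 0 ≤ Real.exp (-(lam * M)) * (t * (K + K)) := by positivity
    have hD := IntegralLE.discountedSum hr.le hr1 (inv_nonneg.2 hr1'.le) hX0 hX k
    have h := ((((hD.const_mul (by positivity : 0 ≤ 1 + θ⁻¹))).add
      ((hm3 k).const_mul hθ0.le)).add (hX k)).const_mul hC₁0.le
    rw [hg]
    refine h.mono ?_
    refine le_trans ?_ (mul_le_mul_of_nonneg_right hCle1 (by positivity))
    rw [hθ2]
    have e1 : C₁ * ((1 + θ⁻¹) * ((1 - r)⁻¹ * (θ ^ 2 * (t * (K + K))) / (1 - r)) + θ * K +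
        θ ^ 2 * (t * (K + K))) =
        C₁ * K * θ * (2 * L * t * (θ + 1) + 1 + 2 * t * θ) := by
      rw [hL]; field_simp; ring
    rw [e1]
    have e2 : 2 * L * t * (θ + 1) + 1 + 2 * t * θ ≤ 2 * L * t * (1 + 1) + 1 + 2 * t * 1 := by
      gcongr
    have ht0 : (0 : ℝ) ≤ t := Nat.cast_nonneg t
    calc _ ≤ C₁ * K * θ * ((4 * L + 3) * (t + 1)) := by
          gcongr
          nlinarith
      _ = _ := by ring
  rw [← hθ]
  refine ⟨?_, lqCost_le_add (h := g) (fun k ω => ?_) hg0 hgI,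
    lqCost_le_add (h := g) (fun k ω => ?_) hg0 hgI⟩
  · refine (lqCost_le (h := fun k ω => 2 * G ^ 3 * (a ^ 2 * 2) * Real.exp (S ω k)) (fun k ω => ?_)
      (fun k ω => by positivity) fun k => ((hm3 k).const_mul (by positivity)).mono hCle2)
    refine (le_abs_self _).trans ((abs_stageCost_switched_le hG hQ hR hK₀ hK₁ _ k).trans ?_)
    have hexp : S ω k ^ 2 ≤ 2 * Real.exp (S ω k) := by
      linarith [Real.quadratic_le_exp_of_nonneg (hS0 ω k), hS0 ω k]
    calc _ ≤ 2 * G ^ 3 * (a * S ω k) ^ 2 := by gcongr; exact hz ω k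
      _ = 2 * G ^ 3 * (a ^ 2 * S ω k ^ 2) := by ring
      _ ≤ 2 * G ^ 3 * (a ^ 2 * (2 * Real.exp (S ω k))) := by gcongr
      _ = _ := by ring
  · linarith [(abs_le.1 (hgap k ω)).2]
  · linarith [(abs_le.1 (hgap k ω)).1]

end Gap

/-! ### Schedules -/

theorem tendsto_atTop_of_isTheta_log {f : ℕ → ℝ} (hf0 : ∀ k, 0 ≤ f k)
    (hf : f =Θ[atTop] fun k : ℕ => Real.log (k : ℝ)) : Tendsto f atTop atTop := by
  have hlog : Tendsto (fun k : ℕ => Real.log (k : ℝ)) atTop atTop :=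
    Real.tendsto_log_atTop.comp tendsto_natCast_atTop_atTop
  have h := hf.tendsto_norm_atTop_iff.2 (tendsto_norm_atTop_atTop.comp hlog)
  exact h.congr fun k => by simp [abs_of_nonneg (hf0 k)]

/-- For thresholds and dwell times of logarithmic order, `(t k + 1) * exp (-(lam * M k / 2))` decays
faster than `k ^ (-α)` once the rate `lam` is large. -/
theorem exists_rate {M : ℕ → ℝ} {t : ℕ → ℕ} (hM0 : ∀ k, 0 ≤ M k)
    (hM : M =Θ[atTop] fun k : ℕ => Real.log (k : ℝ))
    (ht : (fun k => (t k : ℝ)) =Θ[atTop] fun k : ℕ => Real.log (k : ℝ)) {α : ℝ} (hα : 0 < α) :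
    ∃ lam : ℝ, 0 ≤ lam ∧ (fun k => ((t k : ℝ) + 1) * Real.exp (-(lam * M k / 2)))
      =O[atTop] fun k : ℕ => (k : ℝ) ^ (-α) := by
  obtain ⟨a, ha, hMa⟩ := hM.2.exists_pos
  obtain ⟨b, hb, htb⟩ := ht.1.exists_pos
  refine ⟨2 * (α + 1) * a, by positivity, IsBigO.of_bound (b + 1) ?_⟩
  filter_upwards [hMa.bound, htb.bound, eventually_ge_atTop 1] with k h1 h2 hk
  have hk1 : (1 : ℝ) ≤ k := by exact_mod_cast hk
  have hk0 : (0 : ℝ) < k := by linarith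
  have hlog0 : 0 ≤ Real.log k := Real.log_nonneg hk1
  rw [Real.norm_of_nonneg hlog0, Real.norm_of_nonneg (hM0 k)] at h1
  rw [Real.norm_of_nonneg hlog0, Real.norm_of_nonneg (Nat.cast_nonneg _)] at h2
  rw [Real.norm_of_nonneg (by positivity), Real.norm_of_nonneg (by positivity)]
  have h3 : Real.exp (-(2 * (α + 1) * a * M k / 2)) ≤ (k : ℝ) ^ (-α - 1) := by
    rw [Real.rpow_def_of_pos hk0]
    refine Real.exp_le_exp.2 ?_
    nlinarith
  have h4 : (t k : ℝ) + 1 ≤ (b + 1) * k := by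
    have : Real.log k ≤ k := (Real.log_le_sub_one_of_pos hk0).trans (by linarith)
    nlinarith
  calc _ ≤ (b + 1) * k * (k : ℝ) ^ (-α - 1) := by gcongr
    _ = (b + 1) * (k : ℝ) ^ (-α) := by
        rw [mul_assoc, Real.rpow_sub_one hk0.ne']; field_simp

/-! ### Costs along the schedules -/

section Norms

open scoped Matrix.Norms.L2Operator

theorem exists_eventually_gain_bound {n m : ℕ} (B : Matrix (Fin n) (Fin m) ℝ)
    (Q : Matrix (Fin n) (Fin n) ℝ) (R : Matrix (Fin m) (Fin m) ℝ) (K₀ : Matrix (Fin m) (Fin n) ℝ)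
    {K₁ : ℕ → Matrix (Fin m) (Fin n) ℝ} {K : Matrix (Fin m) (Fin n) ℝ}
    (hK₁ : Tendsto K₁ atTop (𝓝 K)) :
    ∃ G : ℝ, 1 ≤ G ∧ ‖Q‖ ≤ G ∧ ‖R‖ ≤ G ∧ ‖K₀‖ ≤ G ∧
      ∀ᶠ k in atTop, ‖K₁ k‖ ≤ G ∧ ‖B * (K₀ - K₁ k)‖ ≤ G := by
  refine ⟨1 + ‖Q‖ + ‖R‖ + ‖K₀‖ + (‖K‖ + 1) + (‖B * (K₀ - K)‖ + 1), ?_, ?_, ?_, ?_, ?_⟩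
  case refine_5 =>
    have hc : Continuous fun F : Matrix (Fin m) (Fin n) ℝ => B * (K₀ - F) := by fun_prop
    have h1 := (hK₁.norm).eventually (gt_mem_nhds (lt_add_one ‖K‖))
    have h2 := (((hc.tendsto K).comp hK₁).norm).eventually
      (gt_mem_nhds (lt_add_one ‖B * (K₀ - K)‖))
    filter_upwards [h1, h2] with k hk1 hk2
    simp only [Function.comp_apply] at hk2
    constructor <;> linarith [norm_nonneg Q, norm_nonneg R, norm_nonneg K₀, norm_nonneg K,
      norm_nonneg (B * (K₀ - K))]
  all_goals linarith [norm_nonneg Q, norm_nonneg R, norm_nonneg K₀, norm_nonneg K,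
    norm_nonneg (B * (K₀ - K))]

/-- The comparison of costs along a sequence of primary gains, with the rate `lam` free. -/
theorem exists_eventually_lqCost_gap {n m : ℕ} {A : Matrix (Fin n) (Fin n) ℝ}
    {B : Matrix (Fin n) (Fin m) ℝ} {Q : Matrix (Fin n) (Fin n) ℝ} {R : Matrix (Fin m) (Fin m) ℝ}
    {Ω : Type*} [MeasurableSpace Ω] {μ : Measure Ω} [IsProbabilityMeasure μ]
    {w : ℕ → Ω → EuclideanSpace ℝ (Fin n)} {ν : Measure (EuclideanSpace ℝ (Fin n))} [IsGaussian ν]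
    (hw : ∀ k, HasLaw (w k) ν μ) {K₀ : Matrix (Fin m) (Fin n) ℝ}
    (hK₀ : IsSchurStable (A + B * K₀)) {K₁ : ℕ → Matrix (Fin m) (Fin n) ℝ}
    {K : Matrix (Fin m) (Fin n) ℝ} (hK₁ : Tendsto K₁ atTop (𝓝 K))
    {P : Matrix (Fin n) (Fin n) ℝ} (hP : P.PosDef) {ρ : ℝ} (hρ0 : 0 < ρ) (hρ1 : ρ < 1)
    (hlyap : ∀ᶠ k in atTop, (ρ • P - (A + B * K₁ k)ᵀ * P * (A + B * K₁ k)).PosDef)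
    {M : ℕ → ℝ} (hM : ∀ k, 0 ≤ M k) {t : ℕ → ℕ} (ht : Tendsto t atTop atTop) {lam : ℝ}
    (hlam : 0 ≤ lam) :
    ∃ C : ℝ, 0 ≤ C ∧ ∀ᶠ k in atTop,
      lqCost A B Q R μ w (switchedController (K₁ k) K₀ (M k) (t k)) ≤ ENNReal.ofReal C ∧
      lqCost A B Q R μ w (switchedController (K₁ k) K₀ (M k) (t k)) ≤
        lqCost A B Q R μ w (linearController (K₁ k)) +
          ENNReal.ofReal (C * ((t k + 1) * Real.exp (-(lam * M k / 2)))) ∧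
      lqCost A B Q R μ w (linearController (K₁ k)) ≤
        lqCost A B Q R μ w (switchedController (K₁ k) K₀ (M k) (t k)) +
          ENNReal.ofReal (C * ((t k + 1) * Real.exp (-(lam * M k / 2)))) := by
  obtain ⟨N₀, c₀, r₀, hc₀, hr₀, hr₀1, hN₀', hN₀, hf₀⟩ :=
    exists_contracting_seminorm (tendsto_pow_of_isSchurStable hK₀)
  obtain ⟨N₁, c₁, hc₁, hN₁', hN₁, hNP⟩ := exists_seminorm_sq_eq_quad hP
  obtain ⟨G, hG, hQ, hR, hK₀G, hGev⟩ := exists_eventually_gain_bound B Q R K₀ hK₁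
  have hsqrt : √ρ < 1 := (Real.sqrt_lt' one_pos).2 (by simpa using hρ1)
  -- replaces a constant by a larger one, so that both norms share `c` and `r`
  have hle : ∀ {E : Type} (N : E → ℝ) (N' : E → ℝ) (_ : ∀ x, 0 ≤ N' x) {b b' : ℝ} (_ : b ≤ b')
      (_ : ∀ x, N x ≤ b * N' x) (x : E), N x ≤ b' * N' x :=
    fun N N' h0 _ _ hb h x => (h x).trans (mul_le_mul_of_nonneg_right hb (h0 x))
  obtain ⟨C, t₁, hC, hmain⟩ := exists_lqCost_gap (A := A) (B := B) (Q := Q) (R := R) (K₀ := K₀)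
    (N₀ := N₀) (N₁ := N₁) (c := max c₀ c₁) (r := max r₀ √ρ) (G := G) (lam := lam) hw
    (hc₀.trans (le_max_left _ _)) (hr₀.trans_le (le_max_left _ _)) (max_lt hr₀1 hsqrt) hG hQ hR hK₀G
    (hle _ _ (fun _ => norm_nonneg _) (le_max_left _ _) hN₀)
    (hle _ _ (fun _ => apply_nonneg _ _) (le_max_left _ _) hN₀')
    (hle _ _ (fun _ => norm_nonneg _) (le_max_right _ _) hN₁)
    (hle _ _ (fun _ => apply_nonneg _ _) (le_max_right _ _) hN₁')
    (hle (fun x => N₀ (act (A + B * K₀) x)) _ (fun _ => apply_nonneg _ _) (le_max_left _ _) hf₀)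
    hlam
  refine ⟨C, hC, ?_⟩
  filter_upwards [hlyap, hGev, ht.eventually_ge_atTop t₁] with k hk hGk htk
  exact hmain (K₁ k) (M k) (t k) (hM k) htk hGk.1 hGk.2
    (hle (fun x => N₁ (act (A + B * K₁ k) x)) _ (fun _ => apply_nonneg _ _) (le_max_right _ _)
      (seminorm_act_le hρ0.le hNP hk))

end Norms

end SwitchedLQR

theorem mainTheorem5 {n m : ℕ}
    (A : Matrix (Fin n) (Fin n) ℝ) (B : Matrix (Fin n) (Fin m) ℝ)
    (Q : Matrix (Fin n) (Fin n) ℝ) (R : Matrix (Fin m) (Fin m) ℝ) (W : Matrix (Fin n) (Fin n) ℝ)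
    (hQ : Q.PosDef) (hR : R.PosDef) (hW : W.PosDef)
    -- the process noise: independent, with law `N(0, W)`
    {Ω : Type*} [MeasurableSpace Ω] (μ : Measure Ω) [IsProbabilityMeasure μ]
    (w : ℕ → Ω → EuclideanSpace ℝ (Fin n)) (hw_indep : iIndepFun w μ)
    (hw_law : ∀ k, HasLaw (w k) (multivariateGaussian 0 W) μ)
    -- the stabilizing fallback gain, and the optimal gain `lqrGain A B R Pstar`
    (K₀ : Matrix (Fin m) (Fin n) ℝ) (hK₀ : SwitchedLQR.IsSchurStable (A + B * K₀))
    (Pstar : Matrix (Fin n) (Fin n) ℝ) (hPstar : SwitchedLQR.IsRiccatiSolution A B Q R Pstar)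
    -- the schedules of primary gains, thresholds and dwell times
    (K₁ : ℕ → Matrix (Fin m) (Fin n) ℝ)
    (hK₁ : Tendsto K₁ atTop (𝓝 (SwitchedLQR.lqrGain A B R Pstar)))
    (M : ℕ → ℝ) (hM_nonneg : ∀ k, 0 ≤ M k)
    (hM : M =Θ[atTop] fun k : ℕ => Real.log (k : ℝ))
    (t : ℕ → ℕ) (ht : (fun k => (t k : ℝ)) =Θ[atTop] fun k : ℕ => Real.log (k : ℝ)) :
    (∃ (P : Matrix (Fin n) (Fin n) ℝ) (ρ : ℝ) (t₀ : ℕ), P.PosDef ∧ 0 < ρ ∧ ρ < 1 ∧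
      (∀ᶠ k in atTop, ∀ s : ℕ, t₀ ≤ s → SwitchedLQR.CommonLyapunov A B (K₁ k) K₀ ρ P s) ∧
      (∀ᶠ k in atTop, t₀ ≤ t k ∧ SwitchedLQR.thresholdLevel A B K₀ W ρ P ≤ M k)) ∧
    (∀ᶠ k in atTop,
      SwitchedLQR.lqCost A B Q R μ w (SwitchedLQR.switchedController (K₁ k) K₀ (M k) (t k)) ≠ ∞ ∧
      SwitchedLQR.lqCost A B Q R μ w (SwitchedLQR.linearController (K₁ k)) ≠ ∞) ∧
    (∀ α : ℝ, 0 < α →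
      (fun k : ℕ =>
        (SwitchedLQR.lqCost A B Q R μ w
          (SwitchedLQR.switchedController (K₁ k) K₀ (M k) (t k))).toReal -
        (SwitchedLQR.lqCost A B Q R μ w (SwitchedLQR.linearController (K₁ k))).toReal)
      =O[atTop] fun k : ℕ => (k : ℝ) ^ (-α)) := by
  have hM_lim := SwitchedLQR.tendsto_atTop_of_isTheta_log hM_nonneg hM
  have ht_lim : Tendsto t atTop atTop :=
    tendsto_natCast_atTop_iff.1
      (SwitchedLQR.tendsto_atTop_of_isTheta_log (fun k => Nat.cast_nonneg (t k)) ht)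
  obtain ⟨ρ, t₀, hρ0, hρ1, hlyap⟩ :=
    SwitchedLQR.exists_eventually_commonLyapunov hQ hR hPstar hK₀ hK₁
  have hgap : ∀ lam : ℝ, 0 ≤ lam → _ := fun lam hlam =>
    SwitchedLQR.exists_eventually_lqCost_gap (A := A) (B := B) (Q := Q) (R := R) (M := M) (t := t)
      (lam := lam) hw_law hK₀ hK₁ hPstar.1 hρ0 hρ1 (hlyap.mono fun k hk => (hk t₀ le_rfl).1)
      hM_nonneg ht_lim hlam
  have hfin : ∀ᶠ k in atTop,
      SwitchedLQR.lqCost A B Q R μ w (SwitchedLQR.switchedController (K₁ k) K₀ (M k) (t k)) ≠ ∞ ∧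
      SwitchedLQR.lqCost A B Q R μ w (SwitchedLQR.linearController (K₁ k)) ≠ ∞ := by
    obtain ⟨C, -, hC⟩ := hgap 0 le_rfl
    filter_upwards [hC] with k hk
    have h1 := ne_top_of_le_ne_top ENNReal.ofReal_ne_top hk.1
    exact ⟨h1, ne_top_of_le_ne_top (ENNReal.add_ne_top.2 ⟨h1, ENNReal.ofReal_ne_top⟩) hk.2.2⟩
  refine ⟨⟨Pstar, ρ, t₀, hPstar.1, hρ0, hρ1, hlyap,
    (ht_lim.eventually_ge_atTop t₀).and (hM_lim.eventually_ge_atTop _)⟩, hfin, fun α hα => ?_⟩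
  obtain ⟨lam, hlam, hrate⟩ := SwitchedLQR.exists_rate hM_nonneg hM ht hα
  obtain ⟨C, hC0, hC⟩ := hgap lam hlam
  refine IsBigO.trans (IsBigO.of_bound C ?_) hrate
  filter_upwards [hC, hfin] with k hk hk'
  obtain ⟨-, h1, h2⟩ := hk
  obtain ⟨hs, hl⟩ := hk'
  have he : 0 ≤ ((t k : ℝ) + 1) * Real.exp (-(lam * M k / 2)) := by positivity
  have h1' := ENNReal.toReal_mono (ENNReal.add_ne_top.2 ⟨hl, ENNReal.ofReal_ne_top⟩) h1
  have h2' := ENNReal.toReal_mono (ENNReal.add_ne_top.2 ⟨hs, ENNReal.ofReal_ne_top⟩) h2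
  rw [ENNReal.toReal_add hl ENNReal.ofReal_ne_top,
    ENNReal.toReal_ofReal (mul_nonneg hC0 he)] at h1'
  rw [ENNReal.toReal_add hs ENNReal.ofReal_ne_top,
    ENNReal.toReal_ofReal (mul_nonneg hC0 he)] at h2'
  rw [Real.norm_of_nonneg he, Real.norm_eq_abs, abs_le]
  constructor <;> linarith
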